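/- **Setting.** Permutations of $\{1,\dots,n\}$ are written in one-line notation. For permutations $\pi$ of length $n$ and $\sigma$ of length $m$: $c(\pi)(j)=n+1-\pi(j)$; $\pi\oplus\sigma$ is $\pi$ followed by $\sigma$ with all entries of $\sigma$ increased by $n$; $\pi\ominus\sigma$ is $\pi$ with all entries increased by $m$, followed by $\sigma$. Besides ordinary permutations (including the empty permutation $\emptyset$ of length $0$) there is the antipermutation $@$, of length $-1$, with $c(@)=@$ and $1\oplus @=@\oplus 1=1\ominus @=@\ominus 1=\emptyset$. A *complete Baxter permutation* is a permutation $\pi$ of odd length $2n+1$ such that $\pi(i)$ is even if and only if $i$ is even and such that, whenever $\pi(x)=i$, $\pi(y)=i+1$ and $z$ lies strictly between $x$ and $y$, we have $\pi(z)<i$ if $i$ is odd and $\pi(z)>i+1$ if $i$ is even. The permutations it induces on its odd and on its even entries (obtained by keeping those entries in order and relabelling them $1,2,\dots$) are, respectively, a *Baxter* and an *anti-Baxter* permutation, and a Baxter and an anti-Baxter permutation are *compatible* if they are induced by the same complete Baxter permutation. A permutation is *alternating* if its ascents and descents alternate, beginning with an ascent, and *doubly alternating* if it and its inverse are alternating.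 A *snow leopard permutation* is an anti-Baxter permutation that is compatible with a doubly alternating Baxter permutation; by convention $@$ is also a snow leopard permutation. For a snow leopard permutation $\pi$ of odd length, $\pi^e$ and $\pi^o$ are the permutations it induces on its even and odd entries, with $@^e=@$ and $@^o=\emptyset$. An *even thread* (*odd thread*) is a permutation of the form $\pi^e$ ($\pi^o$) with $\pi$ a snow leopard permutation of odd length (length $-1$ included). A *Janus thread* is a permutation that is both an even thread and an odd thread; $@$ is also regarded as a Janus thread. $JT_n$ is the set of Janus threads of length $n\ge -1$. A *Motzkin path* of length $n$ is a sequence of $n$ steps $U=(1,1)$, $D=(1,-1)$, $L=(1,0)$ from $(0,0)$ to $(n,0)$ that never goes below the $x$-axis; it is *peakless* if no $U$ is immediately followed by a $D$. $UD_n$ is the set of peakless Motzkin paths of length $n$. For a Janus thread $\gamma$, the *direct path* $\mathcal K(\gamma)$ is defined as follows. $\mathcal K(@)$ is the empty path and $\mathcal K(\emptyset)=L$. If $\gamma$ has length $n\ge1$, write $n+1$, followed by $\gamma$, followed by $0$. For each pair of consecutive entries of this sequence, write $L$ if they are consecutive integers (in either order), and otherwise write $U$ if they form an ascent and $D$ if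 they form a descent. In the resulting sequence of $n+1$ letters, number the letters different from $L$ from left to right, beginning with $1$, and change every odd-numbered $U$ to $D$ and every odd-numbered $D$ to $U$. **Theorem 6.6.** There is a unique map $K$ from the set of all Janus threads to lattice paths that restricts to a bijection $JT_n\to UD_{n+1}$ for every $n\ge-1$ and satisfies - $K(@)$ is the empty path and $K(\emptyset)=L$; - if $\gamma=1\ominus\gamma_1$ for Janus threads $\gamma,\gamma_1$, then $K(\gamma)=L\,K(\gamma_1)$; - if $\gamma=(1\oplus c(\gamma_1)\oplus1)\ominus1\ominus\gamma_2$ for Janus threads $\gamma,\gamma_1,\gamma_2$ with $\gamma_1$ of nonnegative length, then $K(\gamma)=U\,K(\gamma_1)\,D\,K(\gamma_2)$; and for every Janus thread $\gamma$ we have $\mathcal K(\gamma)=K(\gamma)$. -/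

import Mathlib

namespace Janus

/-! ### Permutations in one-line notation, and the antipermutation -/

/-- `w` is the one-line notation `π(1) π(2) … π(n)` of a permutation of `{1, …, n}`. -/
def IsPermWord (w : List ℕ) : Prop :=
  w.Perm (List.range' 1 w.length)

/-- One-line notation of the inverse permutation: the `v`-th entry is the position of `v`. -/
def inverse (w : List ℕ) : List ℕ :=
  (List.range' 1 w.length).map fun v => w.idxOf v + 1

/-- The permutation induced on the even entries `2, 4, 6, …`
(which are relabelled `1, 2, 3, …`, keeping their left-to-right order). -/
def inducedEven (w : List ℕ) : List ℕ :=
  (w.filter fun v => v % 2 = 0).map fun v => v / 2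

/-- The permutation induced on the odd entries `1, 3, 5, …`
(which are relabelled `1, 2, 3, …`, keeping their left-to-right order). -/
def inducedOdd (w : List ℕ) : List ℕ :=
  (w.filter fun v => v % 2 = 1).map fun v => (v + 1) / 2

/-- Ordinary permutations, in one-line notation, together with the antipermutation `@`,
the unique permutation of length `-1`.  (That the word of a `perm` really is a permutation is not
part of this type; it is part of the predicates below.) -/
inductive GPerm : Type
  | anti : GPerm
  | perm (w : List ℕ) : GPerm
  deriving DecidableEq

namespace GPerm

/-- The length, which is `-1` for the antipermutation. -/
def length : GPerm → ℤ
  | anti => -1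
  | perm w => w.length

/-- The permutation `1` of length one. -/
def one : GPerm := perm [1]

/-- The complement: `c(π)(j) = n + 1 - π(j)`, and `c(@) = @`. -/
def compl : GPerm → GPerm
  | anti => anti
  | perm w => perm (w.map fun v => w.length + 1 - v)

/-- `π ⊕ σ`, with the conventions `1 ⊕ @ = @ ⊕ 1 = ∅`.  The remaining sums with `@` are left
undefined in the mathematics; they get a dummy value here and are never used. -/
def directSum : GPerm → GPerm → GPerm
  | perm u, perm v => perm (u ++ v.map fun a => u.length + a)
  | perm [1], anti => perm []
  | anti, perm [1] => perm []
  | _, _ => anti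

/-- `π ⊖ σ`, with the conventions `1 ⊖ @ = @ ⊖ 1 = ∅`.  The remaining sums with `@` are left
undefined in the mathematics; they get a dummy value here and are never used. -/
def skewSum : GPerm → GPerm → GPerm
  | perm u, perm v => perm ((u.map fun a => v.length + a) ++ v)
  | perm [1], anti => perm []
  | anti, perm [1] => perm []
  | _, _ => anti

/-- `π^e`, with `@^e = @`. -/
def evenPart : GPerm → GPerm
  | anti => anti
  | perm w => perm (inducedEven w)

/-- `π^o`, with `@^o = ∅`. -/
def oddPart : GPerm → GPerm
  | anti => perm []
  | perm w => perm (inducedOdd w)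

end GPerm

infixr:65 " ⊕ₚ " => GPerm.directSum
infixr:65 " ⊖ₚ " => GPerm.skewSum

/-! ### Baxter permutations and snow leopard permutations -/

/-- Complete Baxter permutations.  List positions start at `0`, so the position `x` of the list is
the position `x + 1` of the permutation. -/
structure IsCompleteBaxter (w : List ℕ) : Prop where
  isPermWord : IsPermWord w
  odd_length : Odd w.length
  parity : ∀ x v : ℕ, w[x]? = some v → (Even v ↔ Even (x + 1))
  between : ∀ i x y z v : ℕ, w[x]? = some i → w[y]? = some (i + 1) → w[z]? = some v →
    (x < z ∧ z < y ∨ y < z ∧ z < x) → (Odd i → v < i) ∧ (Even i → i + 1 < v)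

/-- (Reduced) Baxter permutations of positive length: those induced by a complete Baxter
permutation on its odd entries. -/
def IsBaxter (s : List ℕ) : Prop :=
  ∃ w, IsCompleteBaxter w ∧ inducedOdd w = s

/-- Anti-Baxter permutations of nonnegative length: those induced by a complete Baxter
permutation on its even entries. -/
def IsAntiBaxter (t : List ℕ) : Prop :=
  ∃ w, IsCompleteBaxter w ∧ inducedEven w = t

/-- The Baxter permutation `s` and the anti-Baxter permutation `t` are compatible. -/
def Compatible (s t : List ℕ) : Prop :=
  ∃ w, IsCompleteBaxter w ∧ inducedOdd w = s ∧ inducedEven w = t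

/-- Alternating (up-down) permutations: ascents and descents alternate, beginning with an
ascent. -/
def IsAlternating (s : List ℕ) : Prop :=
  ∀ x a b : ℕ, s[x]? = some a → s[x + 1]? = some b → (Even x → a < b) ∧ (Odd x → b < a)

def IsDoublyAlternating (s : List ℕ) : Prop :=
  IsAlternating s ∧ IsAlternating (inverse s)

/-- Snow leopard permutations: the anti-Baxter permutations which are compatible with a doubly
alternating Baxter permutation.  By convention `@` is one of them (it is compatible with the empty
permutation). -/
def IsSnowLeopard : GPerm → Prop
  | .anti => True
  | .perm t => IsAntiBaxter t ∧ ∃ s, IsBaxter s ∧ IsDoublyAlternating s ∧ Compatible s t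

/-! ### Threads -/

def IsEvenThread (a : GPerm) : Prop :=
  ∃ p : GPerm, IsSnowLeopard p ∧ Odd p.length ∧ p.evenPart = a

def IsOddThread (b : GPerm) : Prop :=
  ∃ p : GPerm, IsSnowLeopard p ∧ Odd p.length ∧ p.oddPart = b

/-- Janus threads: the permutations which are both even and odd threads, and `@`. -/
def IsJanusThread (g : GPerm) : Prop :=
  g = .anti ∨ (IsEvenThread g ∧ IsOddThread g)

/-- The type of all Janus threads, of all lengths `≥ -1`. -/
abbrev JanusThread : Type := {g : GPerm // IsJanusThread g}

/-- `JT n` is the set of Janus threads of length `n`. -/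
def JT (n : ℤ) : Set JanusThread := {g | g.1.length = n}

/-! ### Peakless Motzkin paths -/

/-- The steps Up, Down and Level. -/
inductive Step : Type
  | U : Step
  | D : Step
  | L : Step
  deriving DecidableEq

namespace Step

/-- The vertical displacement of a step. -/
def rise : Step → ℤ
  | U => 1
  | D => -1
  | L => 0

/-- Exchange `U` and `D`. -/
def flip : Step → Step
  | U => D
  | D => U
  | L => L

end Step

/-- The height at which a path ends when it starts at height `0`. -/
def height (p : List Step) : ℤ := (p.map Step.rise).sum

/-- Motzkin paths: never below the `x`-axis, and ending on it. -/
def IsMotzkin (p : List Step) : Prop :=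
  (∀ k : ℕ, 0 ≤ height (p.take k)) ∧ height p = 0

/-- No Up step is immediately followed by a Down step. -/
def IsPeakless (p : List Step) : Prop := ¬ [Step.U, Step.D] <:+: p

/-- `UD n` is the set of peakless Motzkin paths of length `n`. -/
def UD (n : ℤ) : Set (List Step) := {p | (p.length : ℤ) = n ∧ IsMotzkin p ∧ IsPeakless p}

/-! ### The two maps from Janus threads to lattice paths -/

/-- `K` restricts to bijections `JT n → UD (n + 1)` for all `n ≥ -1`, and obeys the recursion
`K(@) = ∅`, `K(∅) = L`, `K(1 ⊖ γ₁) = L K(γ₁)` and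
`K((1 ⊕ c(γ₁) ⊕ 1) ⊖ 1 ⊖ γ₂) = U K(γ₁) D K(γ₂)`, the last one for `γ₁` of nonnegative length. -/
structure IsRecursiveBijection (K : JanusThread → List Step) : Prop where
  bijOn : ∀ n : ℤ, -1 ≤ n → Set.BijOn K (JT n) (UD (n + 1))
  map_anti : ∀ g : JanusThread, g.1 = .anti → K g = []
  map_empty : ∀ g : JanusThread, g.1 = .perm [] → K g = [.L]
  map_level : ∀ g g₁ : JanusThread, g.1 = .one ⊖ₚ g₁.1 → K g = .L :: K g₁
  map_up : ∀ g g₁ g₂ : JanusThread, 0 ≤ g₁.1.length →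
    g.1 = (.one ⊕ₚ g₁.1.compl ⊕ₚ .one) ⊖ₚ .one ⊖ₚ g₂.1 →
      K g = .U :: (K g₁ ++ .D :: K g₂)

/-- The letter written between consecutive entries `a`, `b`. -/
def letter (a b : ℕ) : Step :=
  if a + 1 = b ∨ b + 1 = a then .L else if a < b then .U else .D

/-- The letters between all the pairs of consecutive entries. -/
def letters (s : List ℕ) : List Step := List.zipWith letter s s.tail

/-- Exchange `U` and `D` at every other non-level step: at the 1st, 3rd, 5th, … one if the flag is
`true`, and at the 2nd, 4th, 6th, … one if it is `false`. -/
def flipAlternate : Bool → List Step → List Step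
  | _, [] => []
  | b, .L :: p => .L :: flipAlternate b p
  | true, s :: p => s.flip :: flipAlternate false p
  | false, s :: p => s :: flipAlternate true p

/-- The direct path `𝒦(γ)`. -/
def directPath : GPerm → List Step
  | .anti => []
  | .perm [] => [.L]
  | .perm w => flipAlternate true (letters ((w.length + 1) :: (w ++ [0])))

end Janus

-- The heart of the matter is `isJanusThread_iff`: the Janus threads are exactly the class
-- `JanusBuilt`, generated from `@` by the two operations of the recursion. Peakless Motzkin paths
-- have the matching unique decomposition: empty, `L p`, or `U p₁ D p₂` with `p₁` Motzkin, peakless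
-- and nonempty. The direct path obeys the recursion (`directPath_lid`, `directPath_up`), hence is a
-- bijection, and any other solution agrees with it by induction.
--
-- The direct path respects `U … D …` because framing `γ₁` by `n + 1` and `0` and then complementing
-- gives `1 ⊕ c(γ₁) ⊕ 1` up to a shift of the values. Complementing exchanges `U` and `D`, the extra
-- descent in front shifts the numbering of the turns by one, and these two effects cancel. A
-- Motzkin path has an even number of turns, so the closing descent is unflipped and the numbering
-- restarts correctly for `γ₂`.
--
-- To identify the Janus threads, complete Baxter permutations of length 3 mod 4 with doubly
-- alternating odd part are decomposed along binary trees (`IsDoublyAltComplete.exists_full`). If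
-- such a permutation does not begin with 1, the entry just below its first entry cuts it into a
-- skew sum; that nothing larger lies beyond the cut is a signed count modulo 4 (`pos_lt_cut`). A
-- summand beginning with 1 is a double arch over a smaller permutation. Taking even parts gives the
-- snow leopard permutations of odd length, and taking parts once more gives a mutual recursion for
-- even and odd threads. Comparing the skew decompositions of a word that is both kinds of thread
-- yields `janusBuilt_of_threads`.

namespace Janus

/-! ### Skew sums, complements and the two ways of enlarging a Janus thread -/

/-- `u ⊖ v` for ordinary permutations. -/
def skew (u v : List ℕ) : List ℕ := u.map (fun a => v.length + a) ++ v

/-- `c(w)` for ordinary permutations. -/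
def comp (w : List ℕ) : List ℕ := w.map fun v => w.length + 1 - v

/-- `1 ⊖ x`. -/
def lid : GPerm → List ℕ
  | .anti => []
  | .perm w => (w.length + 1) :: w

/-- `1 ⊕ c(x) ⊕ 1`. -/
def arch : GPerm → List ℕ
  | .anti => [1]
  | .perm w => 1 :: ((comp w).map (fun a => 1 + a) ++ [w.length + 2])

@[simp] theorem length_comp (w : List ℕ) : (comp w).length = w.length := by simp [comp]

@[simp] theorem length_skew (u v : List ℕ) : (skew u v).length = u.length + v.length := by
  simp [skew]

theorem one_skewSum (x : GPerm) : GPerm.one ⊖ₚ x = .perm (lid x) := by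
  cases x <;> simp [GPerm.one, GPerm.skewSum, lid]

theorem arch_eq (x : GPerm) : GPerm.one ⊕ₚ x.compl ⊕ₚ GPerm.one = .perm (arch x) := by
  cases x <;> simp [GPerm.one, GPerm.directSum, GPerm.compl, arch, comp]
  omega

theorem arch_skewSum (x y : GPerm) :
    (GPerm.one ⊕ₚ x.compl ⊕ₚ GPerm.one) ⊖ₚ GPerm.one ⊖ₚ y = .perm (skew (arch x) (lid y)) := by
  rw [arch_eq, one_skewSum]; rfl

theorem isPermWord_iff {w : List ℕ} :
    IsPermWord w ↔ w.Nodup ∧ ∀ a ∈ w, 1 ≤ a ∧ a ≤ w.length := by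
  constructor
  · intro h
    refine ⟨h.nodup_iff.2 List.nodup_range', fun a ha => ?_⟩
    have := (h.mem_iff).1 ha
    simp at this
    omega
  · rintro ⟨h1, h2⟩
    refine (h1.subperm fun a ha => ?_).perm_of_length_le (by simp)
    have := h2 a ha
    simp
    omega

theorem isPermWord_nil : IsPermWord [] := by simp [isPermWord_iff]

theorem IsPermWord.skew {u v : List ℕ} (hu : IsPermWord u) (hv : IsPermWord v) :
    IsPermWord (skew u v) := by
  rw [isPermWord_iff] at *
  refine ⟨?_, fun a ha => ?_⟩
  · rw [Janus.skew, List.nodup_append]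
    refine ⟨hu.1.map fun _ _ => by simp, hv.1, ?_⟩
    rintro a ha b hb rfl
    obtain ⟨c, hc, rfl⟩ := List.mem_map.1 ha
    have := hu.2 c hc
    have := hv.2 _ hb
    omega
  · rw [length_skew]
    rcases List.mem_append.1 ha with ha | ha
    · obtain ⟨c, hc, rfl⟩ := List.mem_map.1 ha
      have := hu.2 c hc
      omega
    · have := hv.2 _ ha
      omega

theorem IsPermWord.comp {u : List ℕ} (hu : IsPermWord u) : IsPermWord (comp u) := by
  rw [isPermWord_iff] at *
  rw [length_comp]
  refine ⟨hu.1.map_on fun a ha b hb => ?_, fun a ha => ?_⟩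
  · have := hu.2 a ha
    have := hu.2 b hb
    omega
  · obtain ⟨c, hc, rfl⟩ := List.mem_map.1 ha
    have := hu.2 c hc
    omega

theorem comp_comp {u : List ℕ} (hu : IsPermWord u) : comp (comp u) = u := by
  rw [isPermWord_iff] at hu
  simp only [Janus.comp, List.map_map, List.length_map]
  conv_rhs => rw [← List.map_id u]
  refine List.map_congr_left fun a ha => ?_
  have := hu.2 a ha
  simp
  omega

/-- The word of a generalized permutation is a permutation. -/
def GPerm.Valid : GPerm → Prop
  | .anti => True
  | .perm w => IsPermWord w

theorem isPermWord_lid {x : GPerm} (hx : x.Valid) : IsPermWord (lid x) := by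
  cases x with
  | anti => exact isPermWord_nil
  | perm w =>
    have := IsPermWord.skew (u := [1]) (by simp [isPermWord_iff]) hx
    simpa [Janus.skew, lid] using this

theorem isPermWord_arch {x : GPerm} (hx : x.Valid) : IsPermWord (arch x) := by
  cases x with
  | anti => simp [arch, isPermWord_iff]
  | perm w =>
    have h1 : IsPermWord [1] := by simp [isPermWord_iff]
    have := ((h1.skew (IsPermWord.skew hx h1))).comp
    convert this using 1
    simp [Janus.comp, Janus.skew, arch]
    intro a ha
    have := (isPermWord_iff.1 hx).2 a ha
    omega

/-- The permutations built from `@` by `γ₁ ↦ 1 ⊖ γ₁` and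
`(γ₁, γ₂) ↦ (1 ⊕ c(γ₁) ⊕ 1) ⊖ 1 ⊖ γ₂`. -/
inductive JanusBuilt : GPerm → Prop
  | anti : JanusBuilt .anti
  | level {x : GPerm} : JanusBuilt x → JanusBuilt (.perm (lid x))
  | up {u : List ℕ} {x : GPerm} : JanusBuilt (.perm u) → JanusBuilt x →
      JanusBuilt (.perm (skew (arch (.perm u)) (lid x)))

theorem JanusBuilt.valid {x : GPerm} (hx : JanusBuilt x) : x.Valid := by
  induction hx with
  | anti => trivial
  | level _ ih => exact isPermWord_lid ih
  | up _ _ ih₁ ih₂ => exact (isPermWord_arch ih₁).skew (isPermWord_lid ih₂)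

/-! ### The direct path obeys the recursion -/

/-- The word `n + 1, γ, 0` whose consecutive entries give the direct path. -/
def framed (w : List ℕ) : List ℕ := (w.length + 1) :: (w ++ [0])

theorem nodup_framed {w : List ℕ} (hw : IsPermWord w) : (framed w).Nodup := by
  obtain ⟨h1, h2⟩ := isPermWord_iff.1 hw
  rw [framed, List.nodup_cons, List.nodup_append]
  refine ⟨fun h => ?_, h1, by simp, ?_⟩
  · rcases List.mem_append.1 h with h | h
    · have := h2 _ h; omega
    · simp at h
  · rintro a ha b hb rfl
    have := h2 _ ha
    simp at hb
    omega

theorem directPath_perm (w : List ℕ) :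
    directPath (.perm w) = flipAlternate true (letters (framed w)) := by
  cases w with
  | nil => decide
  | cons a w => rfl

@[simp] theorem letters_cons_cons (a b : ℕ) (l : List ℕ) :
    letters (a :: b :: l) = letter a b :: letters (b :: l) := rfl

@[simp] theorem letters_singleton (a : ℕ) : letters [a] = [] := rfl

theorem letters_append (l r : List ℕ) (a : ℕ) :
    letters (l ++ a :: r) = letters (l ++ [a]) ++ letters (a :: r) := by
  induction l with
  | nil => simp
  | cons b l ih =>
    cases l with
    | nil => simp
    | cons c l => simpa using ih

theorem letters_map_add (k : ℕ) (l : List ℕ) : letters (l.map fun a => k + a) = letters l := by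
  induction l with
  | nil => rfl
  | cons a l ih =>
    cases l with
    | nil => rfl
    | cons b l =>
      simp only [List.map_cons, letters_cons_cons] at ih ⊢
      rw [ih]
      congr 1
      unfold letter
      simp [add_assoc]

/-- Reflecting values reverses every comparison and keeps adjacency. Distinctness matters because
`letter a a` is `D` on both sides of the reflection. -/
theorem letters_map_sub (k : ℕ) (l : List ℕ) (h : ∀ a ∈ l, a ≤ k) (hl : l.Nodup) :
    letters (l.map fun a => k - a) = (letters l).map Step.flip := by
  induction l with
  | nil => rfl
  | cons a l ih =>
    cases l with
    | nil => rfl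
    | cons b l =>
      have ha := h a (by simp)
      have hb := h b (by simp)
      have hab : a ≠ b := by rintro rfl; simp at hl
      have ih := ih (fun c hc => h c (List.mem_cons_of_mem _ hc)) hl.of_cons
      simp only [List.map_cons, letters_cons_cons] at ih ⊢
      rw [ih]
      congr 1
      unfold letter
      split_ifs <;> first | rfl | (exfalso; omega)

/-- Whether the number of non-level steps is even. -/
def evenTurns : List Step → Bool
  | [] => true
  | .L :: p => evenTurns p
  | _ :: p => !evenTurns p

theorem flipAlternate_append (b : Bool) (p q : List Step) :
    flipAlternate b (p ++ q) = flipAlternate b p ++ flipAlternate (b == evenTurns p) q := by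
  induction p generalizing b with
  | nil => simp [evenTurns, flipAlternate]
  | cons s p ih =>
    cases s <;> cases b <;> simp [evenTurns, flipAlternate, ih]

theorem flipAlternate_map_flip (b : Bool) (p : List Step) :
    flipAlternate b (p.map Step.flip) = flipAlternate (!b) p := by
  induction p generalizing b with
  | nil => simp [flipAlternate]
  | cons s p ih =>
    cases s <;> cases b <;> simp [flipAlternate, ih, Step.flip]

theorem evenTurns_map_flip (p : List Step) : evenTurns (p.map Step.flip) = evenTurns p := by
  induction p with
  | nil => rfl
  | cons s p ih => cases s <;> simp [evenTurns, ih, Step.flip]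

theorem evenTurns_flipAlternate (b : Bool) (p : List Step) :
    evenTurns (flipAlternate b p) = evenTurns p := by
  induction p generalizing b with
  | nil => simp [flipAlternate]
  | cons s p ih =>
    cases s <;> cases b <;> simp [evenTurns, flipAlternate, ih, Step.flip]

theorem directPath_lid (x : GPerm) : directPath (.perm (lid x)) = .L :: directPath x := by
  cases x with
  | anti => rfl
  | perm w =>
    rw [directPath_perm, directPath_perm]
    simp [lid, framed, flipAlternate, letter]

theorem letters_framed_lid (x : GPerm) :
    flipAlternate true (letters (lid x ++ [0])) = directPath x := by
  cases x with
  | anti => rfl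
  | perm w => rw [directPath_perm]; rfl

/-- The hypothesis `he` on the number of turns is supplied later by `IsMotzkin.evenTurns`, inside
the induction that proves these paths Motzkin. -/
theorem directPath_up (u : List ℕ) (x : GPerm) (hu : IsPermWord u)
    (he : evenTurns (directPath (.perm u)) = true) :
    directPath (.perm (skew (arch (.perm u)) (lid x))) =
      .U :: (directPath (.perm u) ++ .D :: directPath x) := by
  obtain ⟨c, r, hcr, hc⟩ : ∃ c r, lid x ++ [0] = c :: r ∧ c = (lid x).length := by
    cases x <;> simp [lid]
  -- The arch is the complemented frame of `u`, lifted above `lid x`; no further framing of `u` is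
  -- needed.
  have key : framed (skew (arch (.perm u)) (lid x)) =
      ((lid x).length + u.length + 3) ::
        ((((framed u).map fun a => u.length + 1 - a).map fun a => ((lid x).length + 1) + a) ++
          c :: r) := by
    rw [← hcr]
    simp [framed, skew, arch, comp, Function.comp_def]
    refine ⟨by omega, ?_⟩
    congr 1
    · exact List.map_congr_left fun a _ => by omega
    · congr 1; omega
  obtain ⟨A, hA⟩ : ∃ A, ((framed u).map fun a => u.length + 1 - a).map
      (fun a => ((lid x).length + 1) + a) =
        ((lid x).length + 1) :: (A ++ [(lid x).length + u.length + 2]) := by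
    refine ⟨(u.map fun a => u.length + 1 - a).map fun a => ((lid x).length + 1) + a, ?_⟩
    simp [framed]; omega
  have hlet : letters (framed (skew (arch (.perm u)) (lid x))) =
      .D :: ((letters (framed u)).map Step.flip ++ .D :: letters (lid x ++ [0])) := by
    rw [← letters_map_sub (u.length + 1) (framed u),
      ← letters_map_add ((lid x).length + 1) (List.map _ (framed u)), key, hA, List.cons_append,
      letters_cons_cons]
    · have h1 : ((lid x).length + 1) :: (A ++ [(lid x).length + u.length + 2] ++ c :: r) =
          (((lid x).length + 1) :: A) ++ ((lid x).length + u.length + 2) :: c :: r := by simp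
      rw [h1, letters_append, hcr, letters_cons_cons]
      -- Both junctions descend by `u.length + 2 ≥ 2`, so they give `D` and never `L`. For an arch
      -- over `@` they would be level.
      congr 1
      · unfold letter; split_ifs <;> first | rfl | omega
      · congr 2
        unfold letter; split_ifs <;> first | rfl | omega
    · intro a ha
      simp only [framed, List.mem_cons, List.mem_append, List.not_mem_nil, or_false] at ha
      rcases ha with rfl | ha | rfl
      · rfl
      · exact ((isPermWord_iff.1 hu).2 a ha).2.trans (by omega)
      · omega
    · exact nodup_framed hu
  rw [directPath_perm u, evenTurns_flipAlternate] at he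
  rw [directPath_perm, hlet, ← letters_framed_lid x, directPath_perm]
  -- The first `D` becomes `U` and sets the flag to `false`, which undoes the flip coming from the
  -- complement; by `he` the second `D` still sees `false` and survives.
  simp [flipAlternate, flipAlternate_append, flipAlternate_map_flip, evenTurns_map_flip, he,
    Step.flip]

/-! ### Motzkin paths -/

theorem height_append (p q : List Step) : height (p ++ q) = height p + height q := by
  simp [height]

@[simp] theorem height_cons (s : Step) (p : List Step) : height (s :: p) = s.rise + height p := by
  simp [height]

@[simp] theorem height_nil : height [] = 0 := rfl

theorem height_take_append (p q : List Step) (k : ℕ) :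
    height ((p ++ q).take k) = height (p.take k) + height (q.take (k - p.length)) := by
  rw [List.take_append, height_append]

theorem isMotzkin_nil : IsMotzkin [] := by simp [IsMotzkin]

theorem isMotzkin_level {p : List Step} : IsMotzkin (.L :: p) ↔ IsMotzkin p := by
  simp only [IsMotzkin, height_cons, Step.rise, zero_add, and_congr_left_iff]
  intro _
  constructor
  · intro h k; simpa [Step.rise] using h (k + 1)
  · intro h k
    cases k with
    | zero => simp
    | succ k => simpa [Step.rise] using h k

theorem isMotzkin_up {p q : List Step} (hp : IsMotzkin p) :
    IsMotzkin (.U :: (p ++ .D :: q)) ↔ IsMotzkin q := by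
  have h0 := hp.2
  simp only [IsMotzkin, height_cons, height_append, Step.rise, h0]
  constructor
  · rintro ⟨h, h'⟩
    refine ⟨fun k => ?_, by omega⟩
    have := h (k + 1 + p.length + 1)
    rw [List.take_succ_cons, height_cons, height_take_append, List.take_of_length_le (by omega),
      show k + 1 + p.length - p.length = k + 1 by omega, List.take_succ_cons, height_cons, h0] at this
    simp only [Step.rise] at this
    omega
  · rintro ⟨h, h'⟩
    refine ⟨fun k => ?_, by omega⟩
    rcases k with _ | k
    · simp
    rw [List.take_succ_cons, height_cons, height_take_append]
    have h1 := hp.1 k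
    rcases hk : k - p.length with _ | m
    · simp [Step.rise]; omega
    · rw [List.take_succ_cons, height_cons]
      have := h m
      simp only [Step.rise]
      omega

theorem IsMotzkin.evenTurns {p : List Step} (hp : IsMotzkin p) : evenTurns p = true := by
  -- Each turn changes the height by an odd amount, so the parity of the height counts the turns.
  have key : ∀ q : List Step, Janus.evenTurns q = decide (Even (height q)) := by
    intro q
    induction q with
    | nil => simp [Janus.evenTurns]
    | cons s q ih =>
      cases s <;> simp [Janus.evenTurns, ih, Step.rise, Int.even_add, -Int.not_even_iff_odd]
  simp [key, hp.2]

/-- Cut at the first step below the axis. After an initial `U` the remainder goes below −1, so the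
first passage is extracted twice: once to return to the axis, once to leave it. -/
theorem exists_first_return (q : List Step) (k : ℕ) (h : height (q.take k) < 0) :
    ∃ p₁ p₂, q = p₁ ++ .D :: p₂ ∧ IsMotzkin p₁ := by
  induction hn : q.length using Nat.strong_induction_on generalizing q k with
  | _ n ih =>
  subst hn
  match q, k with
  | [], _ => simp at h
  | _ :: _, 0 => simp at h
  | .D :: q, _ => exact ⟨[], q, rfl, isMotzkin_nil⟩
  | .L :: q, k + 1 =>
    obtain ⟨p₁, p₂, rfl, hp⟩ := ih q.length (by simp) q k (by simpa [Step.rise] using h) rfl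
    exact ⟨.L :: p₁, p₂, rfl, isMotzkin_level.2 hp⟩
  | .U :: q, k + 1 =>
    rw [List.take_succ_cons, height_cons, Step.rise] at h
    obtain ⟨p₁, p₂, rfl, hp⟩ := ih q.length (by simp) q k (by omega) rfl
    rw [height_take_append] at h
    have h1 := hp.1 k
    rcases hk : k - p₁.length with _ | m
    · rw [hk] at h; simp at h; omega
    · rw [hk, List.take_succ_cons, height_cons, Step.rise] at h
      obtain ⟨p₃, p₄, rfl, hp'⟩ := ih p₂.length (by simp; omega) p₂ m (by omega) rfl
      exact ⟨.U :: (p₁ ++ .D :: p₃), p₄, by simp, (isMotzkin_up hp).2 hp'⟩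

theorem IsMotzkin.append_D_inj {p p' q q' : List Step} (hp : IsMotzkin p) (hp' : IsMotzkin p')
    (h : p ++ .D :: q = p' ++ .D :: q') : p = p' ∧ q = q' := by
  have aux : ∀ {p p' q q' : List Step}, IsMotzkin p → IsMotzkin p' →
      p ++ .D :: q = p' ++ .D :: q' → p'.length ≤ p.length := by
    intro p p' q q' hp hp' h
    by_contra hlt
    -- If `p` were shorter, its prefix followed by `D`, of height −1, would be a prefix of the
    -- Motzkin path `p'`.
    have h1 := congrArg (fun l => height (l.take (p.length + 1))) h
    simp only [height_take_append] at h1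
    have h2 := hp'.1 (p.length + 1)
    rw [List.take_of_length_le (by omega), show p.length + 1 - p.length = 1 by omega,
      show p.length + 1 - p'.length = 0 by omega, hp.2] at h1
    simp [Step.rise] at h1
    omega
  have hl : p.length = p'.length := le_antisymm (aux hp' hp h.symm) (aux hp hp' h)
  obtain ⟨h1, h2⟩ := List.append_inj h hl
  exact ⟨h1, by simpa using h2⟩

theorem isPeakless_iff {p : List Step} :
    IsPeakless p ↔ p.IsChain fun a b => ¬(a = .U ∧ b = .D) := by
  rw [List.isChain_iff_forall_rel_of_append_cons_cons]
  constructor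
  · rintro h a b l₁ l₂ hl ⟨rfl, rfl⟩
    exact h ⟨l₁, l₂, by simp [hl]⟩
  · rintro h ⟨l₁, l₂, hl⟩
    exact h (a := .U) (b := .D) (l₁ := l₁) (l₂ := l₂) (by simp [← hl]) ⟨rfl, rfl⟩

/-- A nonempty Motzkin path neither starts with `D` nor ends with `U`, so the two added steps create
a peak only when `p` is empty. -/
theorem isPeakless_up {p q : List Step} (hp : IsMotzkin p) :
    IsPeakless (.U :: (p ++ .D :: q)) ↔ p ≠ [] ∧ IsPeakless p ∧ IsPeakless q := by
  simp only [isPeakless_iff]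
  constructor
  · intro h
    refine ⟨?_, h.infix ⟨[.U], .D :: q, by simp⟩, h.infix ⟨.U :: (p ++ [.D]), [], by simp⟩⟩
    rintro rfl
    simp at h
  · rintro ⟨hne, h1, h2⟩
    rw [List.isChain_cons, List.isChain_append]
    refine ⟨?_, h1, ?_, ?_⟩
    · obtain ⟨s, p, rfl⟩ := List.exists_cons_of_ne_nil hne
      rintro y hy ⟨-, rfl⟩
      simp at hy
      subst hy
      have := hp.1 1
      simp [Step.rise] at this
    · rw [List.isChain_cons]
      exact ⟨by simp, h2⟩
    · rintro x hx y - ⟨rfl, -⟩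
      obtain ⟨p', rfl⟩ : ∃ p', p = p' ++ [.U] := by
        rw [Option.mem_def, List.getLast?_eq_some_iff] at hx
        exact hx
      have h3 := hp.1 p'.length
      have h4 := hp.2
      rw [List.take_left'] at h3
      · simp [height_append, Step.rise] at h4; omega
      · rfl

theorem isPeakless_level {p : List Step} : IsPeakless (.L :: p) ↔ IsPeakless p := by
  simp [isPeakless_iff, List.isChain_cons]


/-! ### Even and odd threads of the snow leopard permutations, indexed by binary trees -/

inductive BinTree : Type
  | leaf : BinTree
  | node (a b : BinTree) : BinTree

namespace BinTree

/-- `@`, and `(1 ⊕ c(π₁) ⊕ 1) ⊖ 1 ⊖ π₂`. -/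
def snow : BinTree → GPerm
  | leaf => .anti
  | node a b => .perm (skew (arch (snow a)) (lid (snow b)))

mutual
/-- The even part of `BinTree.snow`. -/
def evenThread : BinTree → GPerm
  | leaf => .anti
  | node a b => .perm (skew (comp (oddThread a)) (lid (evenThread b)))

/-- The odd part of `BinTree.snow`. -/
def oddThread : BinTree → List ℕ
  | leaf => []
  | node a b => skew (arch (evenThread a)) (oddThread b)
end

end BinTree

open BinTree

theorem valid_threads (t : BinTree) : (evenThread t).Valid ∧ IsPermWord (oddThread t) := by
  induction t with
  | leaf => exact ⟨by simp [evenThread, GPerm.Valid], by simpa [oddThread] using isPermWord_nil⟩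
  | node a b iha ihb =>
    simp only [evenThread, oddThread]
    exact ⟨iha.2.comp.skew (isPermWord_lid ihb.1), (isPermWord_arch iha.1).skew ihb.2⟩

-- Skew sums: cancellation, common refinement, indecomposability.

theorem skew_assoc (u v w : List ℕ) : skew (skew u v) w = skew u (skew v w) := by
  simp [skew, Function.comp_def, ← add_assoc, add_comm]

@[simp] theorem skew_nil (u : List ℕ) : skew u [] = u := by simp [skew]

@[simp] theorem nil_skew (u : List ℕ) : skew [] u = u := by simp [skew]

theorem lid_perm (w : List ℕ) : lid (.perm w) = skew [1] w := by simp [lid, skew]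

theorem comp_arch_perm {u : List ℕ} (hu : IsPermWord u) :
    comp (arch (.perm u)) = skew [1] (skew u [1]) := by
  have h1 : IsPermWord [1] := by simp [isPermWord_iff]
  rw [← comp_comp (h1.skew (hu.skew h1))]
  congr 1
  simp [comp, skew, arch]
  intro a ha
  have := (isPermWord_iff.1 hu).2 a ha
  omega

theorem arch_ne_nil (x : GPerm) : arch x ≠ [] := by cases x <;> simp [arch]

theorem eq_anti_of_length_arch_le {x : GPerm} (h : (arch x).length ≤ 1) : x = .anti := by
  cases x with
  | anti => rfl
  | perm w => simp [arch] at h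

theorem oddThread_node_ne_nil (a b : BinTree) : oddThread (node a b) ≠ [] := by
  simp [oddThread, skew, arch_ne_nil]

theorem skew_inj {u v u' v' : List ℕ} (h : skew u v = skew u' v') (hl : u.length = u'.length) :
    u = u' ∧ v = v' := by
  obtain ⟨h1, rfl⟩ := List.append_inj h (by simpa using hl)
  refine ⟨?_, rfl⟩
  exact (List.map_injective_iff.2 fun _ _ => by simp) h1

/-- Two skew decompositions have a common refinement. The overlap lies in the lifted copy of `u'`,
so its entries are at least `v'.length` and can be lowered to give `m`. -/
theorem exists_of_skew_eq_skew {u v u' v' : List ℕ} (h : skew u v = skew u' v')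
    (hl : u.length ≤ u'.length) : ∃ m, u' = skew u m ∧ v = skew m v' := by
  have hlen := congrArg List.length h
  simp only [length_skew] at hlen
  obtain ⟨l, hl1, hl2⟩ : ∃ l, u'.map (fun a => v'.length + a) =
      u.map (fun a => v.length + a) ++ l ∧ v = l ++ v' := by
    rcases List.append_eq_append_iff.1 h with ⟨l, h1, h2⟩ | ⟨l, h1, h2⟩
    · exact ⟨l, h1, h2⟩
    · have : l = [] := by
        have := congrArg List.length h1
        rw [← List.length_eq_zero_iff]
        simp at this
        omega
      subst this
      exact ⟨[], by simpa using h1.symm, by simpa using h2.symm⟩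
  have hll : l.length + v'.length = v.length := by simp [hl2]
  have hle : ∀ a ∈ l, v'.length ≤ a := by
    intro a ha
    have : a ∈ u'.map (fun a => v'.length + a) := by rw [hl1]; simp [ha]
    obtain ⟨c, -, rfl⟩ := List.mem_map.1 this
    omega
  have hm : (l.map fun a => a - v'.length).map (fun a => v'.length + a) = l := by
    rw [List.map_map]
    conv_rhs => rw [← List.map_id l]
    refine List.map_congr_left fun a ha => ?_
    have := hle a ha
    simp
    omega
  refine ⟨l.map fun a => a - v'.length, ?_, ?_⟩
  · apply (List.map_injective_iff.2 (add_right_injective v'.length))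
    rw [hl1, skew, List.map_append, hm, List.map_map]
    congr 1
    refine List.map_congr_left fun a _ => ?_
    simp
    omega
  · rw [skew, hm, hl2]

/-- An arch is skew indecomposable: its last entry is its largest, hence the largest of the whole
word. A nonempty `u` ending earlier would leave that entry in `v'`, whose values are too small. -/
theorem length_arch_le {x : GPerm} {u v v' : List ℕ} (h : skew (arch x) v = skew u v')
    (hv' : IsPermWord v') (hu : u ≠ []) : (arch x).length ≤ u.length := by
  obtain ⟨l, hl⟩ : ∃ l, arch x = l ++ [(arch x).length] := by
    cases x with
    | anti => exact ⟨[], rfl⟩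
    | perm w => exact ⟨1 :: (comp w).map (fun a => 1 + a), by simp [arch]⟩
  have hlen := congrArg List.length h
  simp only [length_skew] at hlen
  have hlen' := congrArg List.length hl
  simp only [List.length_append, List.length_singleton] at hlen'
  have hpos := List.length_pos_iff.2 hu
  by_contra hlt
  have h1 : (skew (arch x) v)[l.length]? = some (v.length + (arch x).length) := by
    rw [skew, List.getElem?_append_left (by simp; omega), List.getElem?_map]
    conv_lhs => rw [hl]
    simp only [List.getElem?_concat_length, Option.map_some]
  rw [h, skew, List.getElem?_append_right (by simp; omega)] at h1
  have := (isPermWord_iff.1 hv').2 _ (List.mem_of_getElem? h1)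
  omega

/-- A skew sum of nonempty permutations begins higher than it ends, and complementing reverses this.
-/
theorem comp_skew_ne_skew {p q p' q' : List ℕ} (hp : IsPermWord p) (hq : IsPermWord q)
    (hq' : IsPermWord q') (hp' : IsPermWord p')
    (h : p ≠ []) (h1 : q ≠ []) (h2 : p' ≠ []) (h3 : q' ≠ []) :
    comp (skew p q) ≠ skew p' q' := by
  have key : ∀ p q : List ℕ, IsPermWord p → IsPermWord q → p ≠ [] → q ≠ [] →
      ∃ a b l, skew p q = a :: (l ++ [b]) ∧ b < a := by
    intro p q hp hq h h1
    obtain ⟨a, p, rfl⟩ := List.exists_cons_of_ne_nil h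
    obtain ⟨l, b, rfl⟩ : ∃ l b, q = l ++ [b] :=
      ⟨q.dropLast, q.getLast h1, (List.dropLast_append_getLast h1).symm⟩
    refine ⟨_, b, p.map (fun a => (l ++ [b]).length + a) ++ l, by simp [skew]; rfl, ?_⟩
    have := (isPermWord_iff.1 hq).2 b (by simp)
    have := (isPermWord_iff.1 hp).2 a (by simp)
    simp at *
    omega
  intro he
  obtain ⟨a, b, l, e, hab⟩ := key p q hp hq h h1
  obtain ⟨a', b', l', e', hab'⟩ := key p' q' hp' hq' h2 h3
  rw [e, e'] at he
  simp only [comp, List.map_cons, List.map_append, List.map_nil, List.cons.injEq] at he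
  obtain ⟨h4, h5⟩ := he
  have h6 := (List.append_inj' h5 rfl).2
  simp only [List.cons.injEq, and_true] at h6
  omega

-- Threads of both kinds are exactly the generated permutations.

theorem exists_oddThread_skew_one (t : BinTree) : ∃ s, oddThread s = skew (oddThread t) [1] := by
  induction t with
  -- The leaf ending the right spine is replaced by a node, which appends an arch over `@`, a single
  -- point.
  | leaf => exact ⟨node leaf leaf, by simp [oddThread, evenThread, arch]⟩
  | node a b iha ihb =>
    obtain ⟨s, hs⟩ := ihb
    exact ⟨node a s, by simp [oddThread, hs, skew_assoc]⟩

theorem oddThread_leaf_node (t : BinTree) : oddThread (node leaf t) = skew [1] (oddThread t) := by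
  simp [oddThread, evenThread, arch]

theorem evenThread_leaf_node (t : BinTree) : evenThread (node leaf t) = .perm (lid (evenThread t)) := by
  simp [oddThread, evenThread, comp]

theorem exists_oddThread_of_one_skew {t : BinTree} {u : List ℕ} (hu : IsPermWord u)
    (h : oddThread t = skew [1] u) : ∃ s, oddThread s = u := by
  cases t with
  | leaf => simp [oddThread, skew] at h
  | node a b =>
    rw [oddThread] at h
    have ha := eq_anti_of_length_arch_le (length_arch_le h hu (by simp))
    rw [ha] at h
    exact ⟨b, (skew_inj h rfl).2⟩

theorem exists_oddThread_of_skew_one {t : BinTree} {u : List ℕ}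
    (h : oddThread t = skew u [1]) : ∃ s, oddThread s = u := by
  have h1 : IsPermWord [1] := by simp [isPermWord_iff]
  induction t generalizing u with
  | leaf => simp [oddThread, skew] at h
  | node a b _ ih =>
    rw [oddThread] at h
    rcases eq_or_ne u [] with rfl | hu
    · exact ⟨leaf, by simp [oddThread]⟩
    · obtain ⟨m, rfl, hm⟩ := exists_of_skew_eq_skew h (length_arch_le h h1 hu)
      obtain ⟨s, rfl⟩ := ih hm
      exact ⟨node a s, by simp [oddThread]⟩

/-- The tree `b` is grafted at the end of the right spine of `a`, where the even thread is `@` and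
its lid is empty. -/
theorem exists_evenThread_skew_lid {a : BinTree} {u : List ℕ} (h : evenThread a = .perm u)
    (b : BinTree) : ∃ t, evenThread t = .perm (skew u (lid (evenThread b))) := by
  induction a generalizing u with
  | leaf => simp [evenThread] at h
  | node c d _ ih =>
    rw [evenThread, GPerm.perm.injEq] at h
    subst h
    cases hd : evenThread d with
    | anti => exact ⟨node c b, by simp [evenThread, lid]⟩
    | perm v =>
      obtain ⟨t, ht⟩ := ih hd
      exact ⟨node c t, by simp [evenThread, ht, lid_perm, skew_assoc]⟩

theorem JanusBuilt.exists_threads {x : GPerm} (hx : JanusBuilt x) :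
    (∃ t, evenThread t = x) ∧ (x = .anti ∨ ∃ t, .perm (oddThread t) = x) := by
  have hlid : ∀ {x : GPerm}, (x = .anti ∨ ∃ t, .perm (oddThread t) = x) →
      ∃ t, oddThread t = lid x := by
    rintro x (rfl | ⟨t, rfl⟩)
    · exact ⟨leaf, by simp [oddThread, lid]⟩
    · exact ⟨node leaf t, by rw [oddThread_leaf_node, lid_perm]⟩
  induction hx with
  | anti => exact ⟨⟨leaf, by simp [evenThread]⟩, .inl rfl⟩
  | level _ ih =>
    obtain ⟨⟨t, rfl⟩, ho⟩ := ih
    obtain ⟨s, hs⟩ := hlid ho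
    exact ⟨⟨node leaf t, evenThread_leaf_node t⟩, .inr ⟨s, by rw [hs]⟩⟩
  | @up u x hu hx ihu ihx =>
    obtain ⟨⟨a, ha⟩, ho⟩ := ihu
    obtain ⟨⟨b, hb⟩, ho'⟩ := ihx
    obtain ⟨s, hs⟩ := hlid ho'
    obtain ⟨c, hc⟩ : ∃ c, oddThread c = u := by simpa using ho
    obtain ⟨d, hd⟩ := exists_oddThread_skew_one c
    -- The tree `node leaf d` has odd thread `1 ⊖ u ⊖ 1`, whose complement is the arch over `u`.
    refine ⟨⟨node (node leaf d) b, ?_⟩, .inr ⟨node a s, ?_⟩⟩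
    · have hu' : (GPerm.perm u).Valid := hu.valid
      rw [evenThread, oddThread_leaf_node, hd, hc, hb, ← comp_arch_perm hu',
        comp_comp (isPermWord_arch hu')]
    · rw [oddThread, ha, hs]

/-- The word is both `c(odd a₁) ⊖ lid(even a₂)` and `arch(even b₁) ⊖ odd b₂`. Indecomposability of
the arch decides how the two decompositions align, and the shape of `a₁` separates the cases. -/
theorem janusBuilt_of_threads {w : List ℕ} (he : ∃ t, evenThread t = .perm w)
    (ho : ∃ t, oddThread t = w) : JanusBuilt (.perm w) := by
  induction hn : w.length using Nat.strong_induction_on generalizing w with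
  | _ n ih =>
  subst hn
  obtain ⟨a, ha⟩ := he
  obtain ⟨b, rfl⟩ := ho
  rcases b with _ | ⟨b₁, b₂⟩
  · simpa [lid, oddThread] using JanusBuilt.level .anti
  rcases a with _ | ⟨a₁, a₂⟩
  · simp [evenThread] at ha
  -- Whenever the leading arch is a single point, the word is `1 ⊖ odd b₂`, and only the even-thread
  -- property of `odd b₂` remains to be shown.
  have step : arch (evenThread b₁) = [1] → (∃ t, evenThread t = .perm (oddThread b₂)) →
      JanusBuilt (.perm (oddThread (node b₁ b₂))) := by
    intro h1 h2
    rw [oddThread, h1, ← lid_perm]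
    exact .level (ih _ (by simp [oddThread, h1]) h2 ⟨_, rfl⟩ rfl)
  have hvl := isPermWord_lid (valid_threads a₂).1
  have hb₂ := (valid_threads b₂).2
  rw [evenThread, GPerm.perm.injEq] at ha
  have hao := ha.symm
  rw [oddThread] at hao
  rcases a₁ with _ | ⟨c₁, c₂⟩
  · have ha0 : lid (evenThread a₂) = skew (arch (evenThread b₁)) (oddThread b₂) := by
      simpa [oddThread, comp] using hao.symm
    have hva := (valid_threads a₂).1
    cases h2 : evenThread a₂ with
    | anti => rw [h2] at ha0; simp [lid, skew, arch_ne_nil] at ha0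
    | perm e =>
      rw [h2] at hva ha0
      rw [lid_perm] at ha0
      have hx := eq_anti_of_length_arch_le (length_arch_le ha0.symm hva (by simp))
      rw [hx] at ha0
      exact step (by rw [hx]; rfl) ⟨a₂, by rw [h2, (skew_inj ha0 rfl).2]⟩
  have hne : comp (oddThread (node c₁ c₂)) ≠ [] := by
    simpa [comp] using oddThread_node_ne_nil c₁ c₂
  -- The leading arch lies inside `c(odd a₁)`; `m` is what remains of that block.
  obtain ⟨m, hm, hm'⟩ := exists_of_skew_eq_skew hao (length_arch_le hao hvl hne)
  rcases c₂ with _ | ⟨d₁, d₂⟩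
  -- Here `odd a₁` is one arch, whose complement is `1` or `1 ⊖ e ⊖ 1`; the leading block is
  -- therefore a single point.
  · have hvc := (valid_threads c₁).1
    cases hc : evenThread c₁ with
    | anti =>
      have hm : skew (arch (evenThread b₁)) m = skew [1] [] := by
        rw [← hm]; simp [oddThread, hc, arch, comp]
      have hx := eq_anti_of_length_arch_le (length_arch_le hm isPermWord_nil (by simp))
      rw [hx] at hm
      have hm0 := (skew_inj hm rfl).2
      subst hm0
      exact step (by rw [hx]; rfl) ⟨node leaf a₂, by rw [evenThread_leaf_node, hm', nil_skew]⟩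
    | perm e =>
      rw [hc] at hvc
      have hve : IsPermWord (skew e [1]) := hvc.skew (by simp [isPermWord_iff])
      have hm : skew (arch (evenThread b₁)) m = skew [1] (skew e [1]) := by
        rw [← hm, ← comp_arch_perm hvc]; simp [oddThread, hc]
      have hx := eq_anti_of_length_arch_le (length_arch_le hm hve (by simp))
      rw [hx] at hm
      have hm0 := (skew_inj hm rfl).2
      subst hm0
      refine step (by rw [hx]; rfl) ?_
      rw [hm', skew_assoc, ← lid_perm, ← evenThread_leaf_node]
      exact exists_evenThread_skew_lid hc _
  -- Now `odd a₁` is skew decomposable, so its complement is not, and it must be the leading arch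
  -- itself.
  · have hm0 : m = [] := by
      by_contra hm0
      rw [oddThread] at hm
      have hvm : IsPermWord m := by
        have h1 := (isPermWord_arch (valid_threads c₁).1).skew (valid_threads (node d₁ d₂)).2
        have h2 := h1.comp
        rw [hm] at h2
        rw [isPermWord_iff] at h2 ⊢
        have h3 : IsPermWord (skew m (lid (evenThread a₂))) := hm' ▸ hb₂
        rw [isPermWord_iff] at h3
        refine ⟨(List.nodup_append.1 h2.1).2.1, fun a ha => ⟨(h2.2 a ?_).1, ?_⟩⟩
        · simp [skew, ha]
        · have := (h3.2 ((lid (evenThread a₂)).length + a) (by simp [skew]; left; exact ha)).2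
          rw [length_skew] at this
          omega
      exact comp_skew_ne_skew (isPermWord_arch (valid_threads c₁).1)
        (valid_threads (node d₁ d₂)).2 hvm (isPermWord_arch (valid_threads b₁).1) (arch_ne_nil _)
        (oddThread_node_ne_nil _ _) (arch_ne_nil _) hm0 hm
    subst hm0
    rw [skew_nil] at hm
    rw [nil_skew] at hm'
    have hvb := (valid_threads b₁).1
    cases hx : evenThread b₁ with
    | anti => exact step (by rw [hx]; rfl) ⟨node leaf a₂, by rw [evenThread_leaf_node, hm']⟩
    | perm e =>
      rw [hx] at hvb hm
      -- Stripping the two extra points from this odd thread shows that `e` is an odd thread; it is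
      -- an even thread through `b₁`.
      have hod : oddThread (node c₁ (node d₁ d₂)) = skew [1] (skew e [1]) := by
        rw [← comp_arch_perm hvb, ← hm, comp_comp (valid_threads _).2]
      have hve : IsPermWord (skew e [1]) := IsPermWord.skew hvb (by simp [isPermWord_iff])
      obtain ⟨s, hs⟩ := exists_oddThread_of_one_skew hve hod
      have hlen : (oddThread (node b₁ b₂)).length = e.length + 2 + (oddThread b₂).length := by
        simp [oddThread, hx, arch]
      have he : JanusBuilt (.perm e) :=
        ih _ (by omega) ⟨b₁, hx⟩ (exists_oddThread_of_skew_one hs) rfl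
      rw [oddThread, hx, hm']
      refine .up he ?_
      have hva := (valid_threads a₂).1
      cases h2 : evenThread a₂ with
      | anti => exact .anti
      | perm v =>
        rw [h2] at hm' hva
        rw [lid_perm] at hm'
        refine ih _ ?_ ⟨a₂, h2⟩ (exists_oddThread_of_one_skew hva hm') rfl
        rw [hlen, hm', length_skew]
        omega


/-! ### Complete Baxter permutations with doubly alternating odd part -/

/-- `f` is a complete Baxter permutation of `{1, …, M}` with inverse `g`, whose odd entries form a
doubly alternating permutation of even length. -/
structure IsDoublyAltComplete (M : ℕ) (f g : ℕ → ℕ) : Prop where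
  len : M % 4 = 3
  val : ∀ x, 1 ≤ x → x ≤ M → 1 ≤ f x ∧ f x ≤ M ∧ g (f x) = x
  pos : ∀ v, 1 ≤ v → v ≤ M → 1 ≤ g v ∧ g v ≤ M ∧ f (g v) = v
  parity : ∀ x, 1 ≤ x → x ≤ M → f x % 2 = x % 2
  mod_four : ∀ x, 1 ≤ x → x ≤ M → x % 2 = 0 → f x % 4 = x % 4
  low : ∀ i, 1 ≤ i → i + 1 ≤ M → i % 2 = 1 → ∀ z,
    (g i < z ∧ z < g (i + 1) ∨ g (i + 1) < z ∧ z < g i) → f z < i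
  high : ∀ i, 1 ≤ i → i + 1 ≤ M → i % 2 = 0 → ∀ z,
    (g i < z ∧ z < g (i + 1) ∨ g (i + 1) < z ∧ z < g i) → i + 1 < f z
  asc : ∀ i, 1 ≤ i → i ≤ M → i % 4 = 2 → g (i - 1) < g i ∧ g i < g (i + 1)
  desc : ∀ i, 1 ≤ i → i ≤ M → i % 4 = 0 → g (i + 1) < g i ∧ g i < g (i - 1)

theorem isDoublyAltComplete_three : IsDoublyAltComplete 3 id id where
  len := rfl
  val x h1 h2 := ⟨h1, h2, rfl⟩
  pos x h1 h2 := ⟨h1, h2, rfl⟩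
  parity _ _ _ := rfl
  mod_four _ _ _ _ := rfl
  low i _ _ _ z hz := by simp at hz; omega
  high i _ _ _ z hz := by simp at hz; omega
  asc i _ _ _ := by simp; omega
  desc i _ _ _ := by omega

namespace IsDoublyAltComplete

-- Closure under double arches, skew sums and reverse complement.

variable {M p q : ℕ} {f g f₁ g₁ f₂ g₂ f' g' : ℕ → ℕ}

/-- Complementing exchanges `low` with `high` and `asc` with `desc`. The two fixed points on each
side restore the residues modulo 4, since `M + 3` is 2 mod 4. -/
theorem arch (h : IsDoublyAltComplete M f g)
    (hf : ∀ x, x ≤ 2 ∨ M + 3 ≤ x → f' x = x)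
    (hf' : ∀ x y, x = y + 2 → 1 ≤ y → y ≤ M → f' x = M + 3 - f y)
    (hg : ∀ x, x ≤ 2 ∨ M + 3 ≤ x → g' x = x)
    (hg' : ∀ v u, v + u = M + 3 → 1 ≤ u → u ≤ M → g' v = g u + 2) :
    IsDoublyAltComplete (M + 4) f' g' := by
  have hM := h.len
  have hcase : ∀ x, 1 ≤ x → x ≤ M + 4 →
      (x ≤ 2 ∨ M + 3 ≤ x) ∨ ∃ y, x = y + 2 ∧ 1 ≤ y ∧ y ≤ M := by
    intro x h1 h2
    by_cases hx : x ≤ 2 ∨ M + 3 ≤ x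
    · exact .inl hx
    · exact .inr ⟨x - 2, by omega⟩
  have hcase' : ∀ v, 1 ≤ v → v ≤ M + 4 →
      (v ≤ 2 ∨ M + 3 ≤ v) ∨ ∃ u, v + u = M + 3 ∧ 1 ≤ u ∧ u ≤ M := by
    intro x h1 h2
    by_cases hx : x ≤ 2 ∨ M + 3 ≤ x
    · exact .inl hx
    · exact .inr ⟨M + 3 - x, by omega⟩
  have hg1 := h.pos 1 (by omega) (by omega)
  have hgM := h.pos M (by omega) (by omega)
  refine ⟨by omega, ?_, ?_, ?_, ?_, ?_, ?_, ?_, ?_⟩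
  · intro x h1 h2
    rcases hcase x h1 h2 with hx | ⟨y, rfl, hy1, hy2⟩
    · rw [hf x hx, hg x hx]; omega
    · have := h.val y hy1 hy2
      rw [hf' _ y rfl hy1 hy2, hg' _ (f y) (by omega) (by omega) (by omega)]; omega
  · intro v h1 h2
    rcases hcase' v h1 h2 with hx | ⟨u, hvu, hy1, hy2⟩
    · rw [hg v hx, hf v hx]; omega
    · have := h.pos u hy1 hy2
      rw [hg' _ u hvu hy1 hy2, hf' _ (g u) rfl (by omega) (by omega)]; omega
  · intro x h1 h2
    rcases hcase x h1 h2 with hx | ⟨y, rfl, hy1, hy2⟩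
    · rw [hf x hx]
    · have := h.val y hy1 hy2
      have := h.parity y hy1 hy2
      rw [hf' _ y rfl hy1 hy2]; omega
  · intro x h1 h2 hx2
    rcases hcase x h1 h2 with hx | ⟨y, rfl, hy1, hy2⟩
    · rw [hf x hx]
    · have := h.val y hy1 hy2
      have := h.mod_four y hy1 hy2 (by omega)
      rw [hf' _ y rfl hy1 hy2]; omega
  · intro i h1 h2 hi z hz
    rcases hcase' i h1 (by omega) with hx | ⟨u, hvu, hu1, hu2⟩
    · rw [hg i hx] at hz
      rw [hg (i + 1) (by omega)] at hz
      omega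
    · rw [hg' i u hvu hu1 hu2] at hz
      have := h.pos u hu1 hu2
      -- The values `M + 2` and `M + 3` straddle the junction with the outer frame, so no inner
      -- condition applies there; one needs only that `1` is taken once.
      by_cases hu : u = 1
      · subst hu
        rw [hg (i + 1) (by omega)] at hz
        have h3 := h.val (z - 2) (by omega) (by omega)
        rw [hf' z (z - 2) (by omega) (by omega) (by omega)]
        have : f (z - 2) ≠ 1 := by intro he; rw [he] at h3; omega
        omega
      · rw [hg' (i + 1) (u - 1) (by omega) (by omega) (by omega)] at hz
        have := h.pos (u - 1) (by omega) (by omega)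
        have h4 := h.high (u - 1) (by omega) (by omega) (by omega) (z - 2)
        rw [show u - 1 + 1 = u by omega] at h4
        have := h4 (by omega)
        rw [hf' z (z - 2) (by omega) (by omega) (by omega)]
        omega
  · intro i h1 h2 hi z hz
    rcases hcase' (i + 1) (by omega) h2 with hx | ⟨u, hvu, hu1, hu2⟩
    · rw [hg (i + 1) hx] at hz
      rw [hg i (by omega)] at hz
      omega
    · rw [hg' (i + 1) u hvu hu1 hu2] at hz
      have := h.pos u hu1 hu2
      by_cases hu : u = M
      · subst hu
        rw [hg i (by omega)] at hz
        have h3 := h.val (z - 2) (by omega) (by omega)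
        rw [hf' z (z - 2) (by omega) (by omega) (by omega)]
        have : f (z - 2) ≠ u := by intro he; rw [he] at h3; omega
        omega
      · rw [hg' i (u + 1) (by omega) (by omega) (by omega)] at hz
        have := h.pos (u + 1) (by omega) (by omega)
        have := h.low u (by omega) (by omega) (by omega) (z - 2) (by omega)
        have := h.val (z - 2) (by omega) (by omega)
        rw [hf' z (z - 2) (by omega) (by omega) (by omega)]
        omega
  · intro i h1 h2 hi
    by_cases hi2 : i = 2
    · subst hi2
      rw [hg 2 (by omega), hg (2 - 1) (by omega), hg' (2 + 1) M (by omega) (by omega) (by omega)]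
      omega
    by_cases hiM : i = M + 3
    · subst hiM
      rw [hg (M + 3) (by omega), hg (M + 3 + 1) (by omega),
        hg' (M + 3 - 1) 1 (by omega) (by omega) (by omega)]
      omega
    · rw [hg' i (M + 3 - i) (by omega) (by omega) (by omega),
        hg' (i - 1) (M + 3 - i + 1) (by omega) (by omega) (by omega),
        hg' (i + 1) (M + 3 - i - 1) (by omega) (by omega) (by omega)]
      have := h.desc (M + 3 - i) (by omega) (by omega) (by omega)
      omega
  · intro i h1 h2 hi
    rw [hg' i (M + 3 - i) (by omega) (by omega) (by omega),
      hg' (i - 1) (M + 3 - i + 1) (by omega) (by omega) (by omega),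
      hg' (i + 1) (M + 3 - i - 1) (by omega) (by omega) (by omega)]
    have := h.asc (M + 3 - i) (by omega) (by omega) (by omega)
    omega

theorem of_arch (h : IsDoublyAltComplete (M + 4) f' g') (hM : M % 4 = 3)
    (h1 : f' 1 = 1) (h2 : f' 2 = 2) (h3 : f' (M + 3) = M + 3) (h4 : f' (M + 4) = M + 4) :
    IsDoublyAltComplete M (fun x => M + 3 - f' (x + 2)) (fun v => g' (M + 3 - v) - 2) := by
  have k1 := h.val 1 (by omega) (by omega)
  have k2 := h.val 2 (by omega) (by omega)
  have k3 := h.val (M + 3) (by omega) (by omega)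
  have k4 := h.val (M + 4) (by omega) (by omega)
  rw [h1] at k1
  rw [h2] at k2
  rw [h3] at k3
  rw [h4] at k4
  have hval : ∀ x, 1 ≤ x → x ≤ M → 3 ≤ f' (x + 2) ∧ f' (x + 2) ≤ M + 2 ∧ g' (f' (x + 2)) = x + 2 := by
    intro x hx hx'
    have h5 := h.val (x + 2) (by omega) (by omega)
    have n1 : f' (x + 2) ≠ 1 := by intro he; rw [he] at h5; omega
    have n2 : f' (x + 2) ≠ 2 := by intro he; rw [he] at h5; omega
    have n3 : f' (x + 2) ≠ M + 3 := by intro he; rw [he] at h5; omega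
    have n4 : f' (x + 2) ≠ M + 4 := by intro he; rw [he] at h5; omega
    omega
  have hpos : ∀ v, 3 ≤ v → v ≤ M + 2 → 3 ≤ g' v ∧ g' v ≤ M + 2 ∧ f' (g' v) = v := by
    intro v hv hv'
    have h5 := h.pos v (by omega) (by omega)
    have n1 : g' v ≠ 1 := by intro he; rw [he] at h5; omega
    have n2 : g' v ≠ 2 := by intro he; rw [he] at h5; omega
    have n3 : g' v ≠ M + 3 := by intro he; rw [he] at h5; omega
    have n4 : g' v ≠ M + 4 := by intro he; rw [he] at h5; omega
    omega
  refine ⟨hM, ?_, ?_, ?_, ?_, ?_, ?_, ?_, ?_⟩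
  · intro x hx hx'
    have := hval x hx hx'
    rw [show M + 3 - (M + 3 - f' (x + 2)) = f' (x + 2) by omega]
    omega
  · intro v hv hv'
    have := hpos (M + 3 - v) (by omega) (by omega)
    rw [show g' (M + 3 - v) - 2 + 2 = g' (M + 3 - v) by omega]
    omega
  · intro x hx hx'
    have := hval x hx hx'
    have := h.parity (x + 2) (by omega) (by omega)
    omega
  · intro x hx hx' hx2
    have := hval x hx hx'
    have := h.mod_four (x + 2) (by omega) (by omega) (by omega)
    omega
  · intro i hi hi' hodd z hz
    have e1 := hpos (M + 3 - i) (by omega) (by omega)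
    have e2 := hpos (M + 3 - (i + 1)) (by omega) (by omega)
    have e3 := h.high (M + 3 - (i + 1)) (by omega) (by omega) (by omega) (z + 2)
    rw [show M + 3 - (i + 1) + 1 = M + 3 - i by omega] at e3
    have := e3 (by omega)
    have := hval z (by omega) (by omega)
    omega
  · intro i hi hi' hodd z hz
    have e1 := hpos (M + 3 - i) (by omega) (by omega)
    have e2 := hpos (M + 3 - (i + 1)) (by omega) (by omega)
    have e3 := h.low (M + 3 - (i + 1)) (by omega) (by omega) (by omega) (z + 2)
    rw [show M + 3 - (i + 1) + 1 = M + 3 - i by omega] at e3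
    have := e3 (by omega)
    have := hval z (by omega) (by omega)
    omega
  · intro i hi hi' hi2
    have e1 := h.desc (M + 3 - i) (by omega) (by omega) (by omega)
    have e2 := hpos (M + 3 - i) (by omega) (by omega)
    have e3 := hpos (M + 3 - (i - 1)) (by omega) (by omega)
    have e4 := hpos (M + 3 - (i + 1)) (by omega) (by omega)
    rw [show M + 3 - i + 1 = M + 3 - (i - 1) by omega,
      show M + 3 - i - 1 = M + 3 - (i + 1) by omega] at e1
    omega
  · intro i hi hi' hi2
    have e1 := h.asc (M + 3 - i) (by omega) (by omega) (by omega)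
    have e2 := hpos (M + 3 - i) (by omega) (by omega)
    have e3 := hpos (M + 3 - (i - 1)) (by omega) (by omega)
    have e4 := hpos (M + 3 - (i + 1)) (by omega) (by omega)
    rw [show M + 3 - i + 1 = M + 3 - (i - 1) by omega,
      show M + 3 - i - 1 = M + 3 - (i + 1) by omega] at e1
    omega

/-- The separating entry `q + 1` at position `p + 1` has both coordinates divisible by 4, so it is a
descent, as the skew sum requires, and the shifts preserve all residues. -/
theorem skew (h₁ : IsDoublyAltComplete p f₁ g₁) (h₂ : IsDoublyAltComplete q f₂ g₂)
    (hf₁ : ∀ x, 1 ≤ x → x ≤ p → f' x = f₁ x + (q + 1)) (hf : f' (p + 1) = q + 1)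
    (hf₂ : ∀ x y, x = y + (p + 1) → 1 ≤ y → y ≤ q → f' x = f₂ y)
    (hg₂ : ∀ v, 1 ≤ v → v ≤ q → g' v = g₂ v + (p + 1)) (hg : g' (q + 1) = p + 1)
    (hg₁ : ∀ v u, v = u + (q + 1) → 1 ≤ u → u ≤ p → g' v = g₁ u) :
    IsDoublyAltComplete (p + 1 + q) f' g' := by
  have hp := h₁.len
  have hq := h₂.len
  have hcase : ∀ m n x, 1 ≤ x → x ≤ m + 1 + n →
      x ≤ m ∨ x = m + 1 ∨ ∃ y, x = y + (m + 1) ∧ 1 ≤ y ∧ y ≤ n := by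
    intro m n x h1 h2
    by_cases hx : x ≤ m + 1
    · omega
    · exact .inr (.inr ⟨x - (m + 1), by omega⟩)
  have e1 := h₁.pos 1 (by omega) (by omega)
  have eq := h₂.pos q (by omega) (by omega)
  refine ⟨by omega, ?_, ?_, ?_, ?_, ?_, ?_, ?_, ?_⟩
  · intro x h1 h2
    rcases hcase p q x h1 h2 with hx | rfl | ⟨y, rfl, hy, hy'⟩
    · have := h₁.val x h1 hx
      rw [hf₁ x h1 hx, hg₁ _ (f₁ x) rfl (by omega) (by omega)]; omega
    · rw [hf, hg]; omega
    · have := h₂.val y hy hy'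
      rw [hf₂ _ y rfl hy hy', hg₂ _ (by omega) (by omega)]; omega
  · intro x h1 h2
    rcases hcase q p x h1 (by omega) with hx | rfl | ⟨y, rfl, hy, hy'⟩
    · have := h₂.pos x h1 hx
      rw [hg₂ x h1 hx, hf₂ _ (g₂ x) rfl (by omega) (by omega)]; omega
    · rw [hg, hf]; omega
    · have := h₁.pos y hy hy'
      rw [hg₁ _ y rfl hy hy', hf₁ _ (by omega) (by omega)]; omega
  · intro x h1 h2
    rcases hcase p q x h1 h2 with hx | rfl | ⟨y, rfl, hy, hy'⟩
    · have := h₁.parity x h1 hx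
      rw [hf₁ x h1 hx]; omega
    · rw [hf]; omega
    · have := h₂.parity y hy hy'
      rw [hf₂ _ y rfl hy hy']; omega
  · intro x h1 h2 hx2
    rcases hcase p q x h1 h2 with hx | rfl | ⟨y, rfl, hy, hy'⟩
    · have := h₁.mod_four x h1 hx (by omega)
      rw [hf₁ x h1 hx]; omega
    · rw [hf]; omega
    · have := h₂.mod_four y hy hy' (by omega)
      rw [hf₂ _ y rfl hy hy']; omega
  · intro i h1 h2 hi z hz
    rcases hcase q p i h1 (by omega) with hx | rfl | ⟨u, rfl, hu, hu'⟩
    · have e2 := h₂.pos i h1 hx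
      rw [hg₂ i h1 hx] at hz
      by_cases hiq : i = q
      · subst hiq
        rw [hg] at hz
        have e3 := h₂.val (z - (p + 1)) (by omega) (by omega)
        have : f₂ (z - (p + 1)) ≠ i := by intro he; rw [he] at e3; omega
        rw [hf₂ z (z - (p + 1)) (by omega) (by omega) (by omega)]
        omega
      · have e3 := h₂.pos (i + 1) (by omega) (by omega)
        rw [hg₂ (i + 1) (by omega) (by omega)] at hz
        rw [hf₂ z (z - (p + 1)) (by omega) (by omega) (by omega)]
        exact h₂.low i h1 (by omega) hi _ (by omega)
    · omega
    · have e2 := h₁.pos u hu hu'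
      have e3 := h₁.pos (u + 1) (by omega) (by omega)
      rw [hg₁ _ u rfl hu hu', hg₁ _ (u + 1) (by omega) (by omega) (by omega)] at hz
      have := h₁.low u hu (by omega) (by omega) z hz
      rw [hf₁ z (by omega) (by omega)]
      omega
  · intro i h1 h2 hi z hz
    rcases hcase q p i h1 (by omega) with hx | rfl | ⟨u, rfl, hu, hu'⟩
    · have e2 := h₂.pos i h1 hx
      have e3 := h₂.pos (i + 1) (by omega) (by omega)
      rw [hg₂ i h1 hx, hg₂ (i + 1) (by omega) (by omega)] at hz
      rw [hf₂ z (z - (p + 1)) (by omega) (by omega) (by omega)]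
      exact h₂.high i h1 (by omega) hi _ (by omega)
    · rw [hg, hg₁ _ 1 (by omega) (by omega) (by omega)] at hz
      have e3 := h₁.val z (by omega) (by omega)
      have : f₁ z ≠ 1 := by intro he; rw [he] at e3; omega
      rw [hf₁ z (by omega) (by omega)]
      omega
    · have e2 := h₁.pos u hu hu'
      have e3 := h₁.pos (u + 1) (by omega) (by omega)
      rw [hg₁ _ u rfl hu hu', hg₁ _ (u + 1) (by omega) (by omega) (by omega)] at hz
      have := h₁.high u hu (by omega) (by omega) z hz
      rw [hf₁ z (by omega) (by omega)]
      omega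
  · intro i h1 h2 hi
    rcases hcase q p i h1 (by omega) with hx | rfl | ⟨u, rfl, hu, hu'⟩
    · rw [hg₂ i h1 hx, hg₂ (i - 1) (by omega) (by omega), hg₂ (i + 1) (by omega) (by omega)]
      have := h₂.asc i h1 hx hi
      omega
    · omega
    · rw [hg₁ _ u rfl hu hu', hg₁ (u + (q + 1) - 1) (u - 1) (by omega) (by omega) (by omega),
        hg₁ (u + (q + 1) + 1) (u + 1) (by omega) (by omega) (by omega)]
      exact h₁.asc u hu hu' (by omega)
  · intro i h1 h2 hi
    rcases hcase q p i h1 (by omega) with hx | rfl | ⟨u, rfl, hu, hu'⟩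
    · rw [hg₂ i h1 hx, hg₂ (i - 1) (by omega) (by omega), hg₂ (i + 1) (by omega) (by omega)]
      have := h₂.desc i h1 hx hi
      omega
    · rw [hg, hg₁ _ 1 (by omega) (by omega) (by omega), show q + 1 - 1 = q by omega,
        hg₂ q (by omega) (by omega)]
      omega
    · rw [hg₁ _ u rfl hu hu', hg₁ (u + (q + 1) - 1) (u - 1) (by omega) (by omega) (by omega),
        hg₁ (u + (q + 1) + 1) (u + 1) (by omega) (by omega) (by omega)]
      exact h₁.desc u hu hu' (by omega)

/-- The reverse complement. -/
theorem reverseComplement (h : IsDoublyAltComplete M f g) :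
    IsDoublyAltComplete M (fun x => M + 1 - f (M + 1 - x)) (fun v => M + 1 - g (M + 1 - v)) := by
  have hM := h.len
  refine ⟨hM, ?_, ?_, ?_, ?_, ?_, ?_, ?_, ?_⟩
  · intro x h1 h2
    have := h.val (M + 1 - x) (by omega) (by omega)
    rw [show M + 1 - (M + 1 - f (M + 1 - x)) = f (M + 1 - x) by omega]
    omega
  · intro x h1 h2
    have := h.pos (M + 1 - x) (by omega) (by omega)
    rw [show M + 1 - (M + 1 - g (M + 1 - x)) = g (M + 1 - x) by omega]
    omega
  · intro x h1 h2
    have := h.val (M + 1 - x) (by omega) (by omega)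
    have := h.parity (M + 1 - x) (by omega) (by omega)
    omega
  · intro x h1 h2 hx
    have := h.val (M + 1 - x) (by omega) (by omega)
    have := h.mod_four (M + 1 - x) (by omega) (by omega) (by omega)
    omega
  · intro i h1 h2 hi z hz
    have e1 := h.pos (M + 1 - i) (by omega) (by omega)
    have e2 := h.pos (M + 1 - (i + 1)) (by omega) (by omega)
    have e3 := h.high (M + 1 - (i + 1)) (by omega) (by omega) (by omega) (M + 1 - z)
    rw [show M + 1 - (i + 1) + 1 = M + 1 - i by omega] at e3
    have := e3 (by omega)
    omega
  · intro i h1 h2 hi z hz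
    have e1 := h.pos (M + 1 - i) (by omega) (by omega)
    have e2 := h.pos (M + 1 - (i + 1)) (by omega) (by omega)
    have e3 := h.low (M + 1 - (i + 1)) (by omega) (by omega) (by omega) (M + 1 - z)
    rw [show M + 1 - (i + 1) + 1 = M + 1 - i by omega] at e3
    have := e3 (by omega)
    omega
  · intro i h1 h2 hi
    have e1 := h.asc (M + 1 - i) (by omega) (by omega) (by omega)
    have e2 := h.pos (M + 1 - i) (by omega) (by omega)
    have e3 := h.pos (M + 1 - (i - 1)) (by omega) (by omega)
    have e4 := h.pos (M + 1 - (i + 1)) (by omega) (by omega)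
    rw [show M + 1 - i + 1 = M + 1 - (i - 1) by omega,
      show M + 1 - i - 1 = M + 1 - (i + 1) by omega] at e1
    omega
  · intro i h1 h2 hi
    have e1 := h.desc (M + 1 - i) (by omega) (by omega) (by omega)
    have e2 := h.pos (M + 1 - i) (by omega) (by omega)
    have e3 := h.pos (M + 1 - (i - 1)) (by omega) (by omega)
    have e4 := h.pos (M + 1 - (i + 1)) (by omega) (by omega)
    rw [show M + 1 - i + 1 = M + 1 - (i - 1) by omega,
      show M + 1 - i - 1 = M + 1 - (i + 1) by omega] at e1
    omega

-- The skew cut at the value just below the first entry.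

/-- `1` on `2 + 4ℤ`, `-1` on `4ℤ`, and `0` on odd numbers. -/
def sign (n : ℕ) : ℤ := if n % 4 = 2 then 1 else if n % 4 = 0 then -1 else 0

theorem sum_sign (k : ℕ) : ∑ x ∈ Finset.Ico 1 (4 * k + 4), sign x = 1 := by
  have h1 : ∀ k, sign (4 * k + 1) = 0 := fun k => by unfold sign; split_ifs <;> omega
  have h2 : ∀ k, sign (4 * k + 2) = 1 := fun k => by unfold sign; split_ifs <;> omega
  have h3 : ∀ k, sign (4 * k + 3) = 0 := fun k => by unfold sign; split_ifs <;> omega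
  have h4 : ∀ k, sign (4 * k + 4) = -1 := fun k => by unfold sign; split_ifs <;> omega
  induction k with
  | zero => decide
  | succ k ih =>
    have := h1 (k + 1)
    have := h2 (k + 1)
    have := h3 (k + 1)
    rw [show 4 * (k + 1) + 4 = 4 * (k + 1) + 3 + 1 by ring,
      Finset.sum_Ico_succ_top (by omega), Finset.sum_Ico_succ_top (by omega),
      Finset.sum_Ico_succ_top (by omega), Finset.sum_Ico_succ_top (by omega),
      show 4 * (k + 1) = 4 * k + 4 by ring, ih, h4]
    simp only [show 4 * k + 4 = 4 * (k + 1) by ring, h1, h2, h3]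
    rfl

/-- All entries before the entry `f 1 - 1` are at least `f 1`, and `f 1 - 1` sits at a position
divisible by `4`. -/
theorem first_cut (h : IsDoublyAltComplete M f g) (h1 : 1 < f 1) :
    f 1 % 4 = 1 ∧ g (f 1 - 1) % 4 = 0 ∧ ∀ x, 1 ≤ x → x < g (f 1 - 1) → f 1 ≤ f x := by
  have hM := h.len
  have e1 := h.val 1 (by omega) (by omega)
  have e2 := h.parity 1 (by omega) (by omega)
  have e3 := h.pos (f 1 - 1) (by omega) (by omega)
  have e4 : f 1 % 4 = 1 := by
    by_contra hne
    -- An ascent at the value `f 1 - 1` would place it before position 1.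
    have := h.asc (f 1 - 1) (by omega) (by omega) (by omega)
    rw [show f 1 - 1 + 1 = f 1 by omega] at this
    omega
  refine ⟨e4, ?_, ?_⟩
  · have e5 := h.parity (g (f 1 - 1)) (by omega) (by omega)
    have e6 := h.mod_four (g (f 1 - 1)) (by omega) (by omega) (by omega)
    omega
  · intro x hx hx'
    rcases Nat.eq_or_lt_of_le hx with rfl | hx
    · exact le_rfl
    · have := h.high (f 1 - 1) (by omega) (by omega) (by omega) x
      rw [show f 1 - 1 + 1 = f 1 by omega] at this
      have := this (by omega)
      omega

/-- Values are added in blocks of four. A block contributes −1 if its multiple of 4 precedes the cut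
and +1 if its 2 mod 4 value does; the latter forces the former, so the sum never grows. Once all
earlier values precede the cut, so does the multiple of 4, and keeping the sum at 1 forces the rest.
-/
theorem sum_before_cut_le (h : IsDoublyAltComplete M f g) (h1 : 1 < f 1) (k : ℕ)
    (hk : f 1 + 2 + 4 * k ≤ M) :
    ∑ i ∈ Finset.Ico (f 1) (f 1 + 3 + 4 * k), (if g i < g (f 1 - 1) then sign i else 0) ≤ 1 ∧
      (∑ i ∈ Finset.Ico (f 1) (f 1 + 3 + 4 * k), (if g i < g (f 1 - 1) then sign i else 0) = 1 →
        ∀ i, f 1 ≤ i → i ≤ f 1 + 2 + 4 * k → g i < g (f 1 - 1)) := by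
  obtain ⟨hv, hr, hcut⟩ := h.first_cut h1
  have hM := h.len
  have e1 := h.val 1 (by omega) (by omega)
  have e3 := h.pos (f 1 - 1) (by omega) (by omega)
  generalize hvv : f 1 = v at *
  generalize hrr : g (v - 1) = r at *
  have hs0 : ∀ i, i % 2 = 1 → sign i = 0 := fun i hi => by unfold sign; split_ifs <;> omega
  have hs2 : ∀ i, i % 4 = 2 → sign i = 1 := fun i hi => by unfold sign; split_ifs <;> omega
  have hs4 : ∀ i, i % 4 = 0 → sign i = -1 := fun i hi => by unfold sign; split_ifs <;> omega
  -- Entries between `i` and `i + 1` exceed both, so the smaller cut entry `v - 1` cannot separate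
  -- them.
  have hiff : ∀ i, v ≤ i → i + 1 ≤ M → i % 2 = 0 → (g i < r ↔ g (i + 1) < r) := by
    intro i hi hi' hi2
    have a1 := h.pos i (by omega) (by omega)
    have a2 := h.pos (i + 1) (by omega) (by omega)
    have a3 := h.high i (by omega) (by omega) hi2 r
    have a4 : g i ≠ r := by intro he; rw [he] at a1; omega
    have a5 : g (i + 1) ≠ r := by intro he; rw [he] at a2; omega
    omega
  induction k with
  | zero =>
    have b1 := hiff (v + 1) (by omega) (by omega) (by omega)
    have b2 : g v < r := by
      have : r ≠ 1 := by omega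
      omega
    rw [mul_zero, add_zero, Finset.sum_Ico_succ_top (by omega), Finset.sum_Ico_succ_top (by omega),
      Finset.sum_Ico_succ_top (by omega), hs0 v (by omega), hs2 (v + 1) (by omega),
      hs0 (v + 2) (by omega)]
    simp only [Finset.Ico_self, Finset.sum_empty, ite_self, add_zero, zero_add]
    refine ⟨by split_ifs <;> simp, fun hb i hi hi' => ?_⟩
    have b3 : g (v + 1) < r := by by_contra hc; simp [hc] at hb
    have : i = v ∨ i = v + 1 ∨ i = v + 1 + 1 := by omega
    rcases this with rfl | rfl | rfl
    · exact b2
    · exact b3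
    · exact b1.1 b3
  | succ k ih =>
    obtain ⟨ih1, ih2⟩ := ih (by omega)
    set y := v + 2 + 4 * k with hy
    have b1 := hiff (y + 1) (by omega) (by omega) (by omega)
    have b2 := hiff (y + 3) (by omega) (by omega) (by omega)
    have c1 := h.desc (y + 1) (by omega) (by omega) (by omega)
    have c2 := h.asc (y + 3) (by omega) (by omega) (by omega)
    rw [show y + 1 - 1 = y by omega] at c1
    rw [show y + 3 - 1 = y + 2 by omega] at c2
    rw [show v + 3 + 4 * k = y + 1 by omega] at ih1 ih2
    rw [show v + 3 + 4 * (k + 1) = y + 1 + 1 + 1 + 1 + 1 by omega,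
      Finset.sum_Ico_succ_top (by omega), Finset.sum_Ico_succ_top (by omega),
      Finset.sum_Ico_succ_top (by omega), Finset.sum_Ico_succ_top (by omega),
      hs4 (y + 1) (by omega), hs0 (y + 1 + 1) (by omega), hs2 (y + 1 + 1 + 1) (by omega),
      hs0 (y + 1 + 1 + 1 + 1) (by omega)]
    simp only [ite_self, add_zero]
    simp only [add_assoc, Nat.reduceAdd] at *
    generalize ∑ i ∈ Finset.Ico v (y + 1), (if g i < r then sign i else 0) = S at *
    constructor
    · split_ifs <;> omega
    · intro hS
      have hS1 : S = 1 := by split_ifs at hS <;> omega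
      have hall := ih2 hS1
      have d0 : g y < r := hall y (by omega) (by omega)
      have d1 : g (y + 1) < r := by omega
      have d3 : g (y + 3) < r := by
        by_contra hc
        rw [if_pos d1, if_neg hc] at hS
        omega
      intro i hi hi'
      by_cases hiy : i ≤ y
      · exact hall i hi (by omega)
      · have : i = y + 1 ∨ i = y + 2 ∨ i = y + 3 ∨ i = y + 4 := by omega
        rcases this with rfl | rfl | rfl | rfl
        · exact d1
        · exact b1.1 d1
        · exact d3
        · exact b2.1 d3

/-- The positions before the cut have total sign 1, and even entries agree with their positions
modulo 4. Hence the values before the cut also have total sign 1, the equality case of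
`sum_before_cut_le`. -/
theorem pos_lt_cut (h : IsDoublyAltComplete M f g) (h1 : 1 < f 1) :
    ∀ i, f 1 ≤ i → i ≤ M → g i < g (f 1 - 1) := by
  obtain ⟨hv, hr, hcut⟩ := h.first_cut h1
  have hM := h.len
  have e1 := h.val 1 (by omega) (by omega)
  have e3 := h.pos (f 1 - 1) (by omega) (by omega)
  obtain ⟨k, hk⟩ : ∃ k, M = f 1 + 2 + 4 * k := ⟨(M - f 1) / 4, by omega⟩
  obtain ⟨l, hl⟩ : ∃ l, g (f 1 - 1) = 4 * l + 4 := ⟨g (f 1 - 1) / 4 - 1, by omega⟩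
  have hsum : ∑ i ∈ Finset.Ico (f 1) (f 1 + 3 + 4 * k),
      (if g i < g (f 1 - 1) then sign i else 0) = 1 := by
    rw [← sum_sign l, ← hl, ← Finset.sum_filter]
    refine Finset.sum_nbij' g f ?_ ?_ ?_ ?_ ?_
    · intro i hi
      simp only [Finset.mem_filter, Finset.mem_Ico] at hi ⊢
      have := h.pos i (by omega) (by omega)
      omega
    · intro x hx
      simp only [Finset.mem_filter, Finset.mem_Ico] at hx ⊢
      have := h.val x (by omega) (by omega)
      have := hcut x (by omega) (by omega)
      omega
    · intro i hi
      simp only [Finset.mem_filter, Finset.mem_Ico] at hi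
      exact (h.pos i (by omega) (by omega)).2.2
    · intro x hx
      simp only [Finset.mem_Ico] at hx
      exact (h.val x (by omega) (by omega)).2.2
    · intro i hi
      simp only [Finset.mem_filter, Finset.mem_Ico] at hi
      have a1 := h.pos i (by omega) (by omega)
      have a2 := h.parity (g i) (by omega) (by omega)
      have a3 := h.mod_four (g i) (by omega) (by omega)
      unfold sign
      rw [a1.2.2] at a2 a3
      split_ifs <;> omega
  intro i hi hi'
  exact (h.sum_before_cut_le h1 k (by omega)).2 hsum i hi (by omega)

/-- The positions before the cut biject with the values from `f 1` to `M`. -/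
theorem cut_add (h : IsDoublyAltComplete M f g) (h1 : 1 < f 1) : g (f 1 - 1) + f 1 = M + 2 := by
  obtain ⟨hv, hr, hcut⟩ := h.first_cut h1
  have hM := h.len
  have e1 := h.val 1 (by omega) (by omega)
  have e3 := h.pos (f 1 - 1) (by omega) (by omega)
  have hlt := h.pos_lt_cut h1
  have : (Finset.Ico 1 (g (f 1 - 1))).card = (Finset.Ico (f 1) (M + 1)).card := by
    refine Finset.card_nbij' f g ?_ ?_ ?_ ?_
    · intro x hx
      simp only [Finset.coe_Ico, Set.mem_Ico] at hx ⊢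
      have := h.val x (by omega) (by omega)
      have := hcut x (by omega) (by omega)
      omega
    · intro i hi
      simp only [Finset.coe_Ico, Set.mem_Ico] at hi ⊢
      have := h.pos i (by omega) (by omega)
      have := hlt i (by omega) (by omega)
      omega
    · intro x hx
      simp only [Finset.coe_Ico, Set.mem_Ico] at hx
      exact (h.val x (by omega) (by omega)).2.2
    · intro i hi
      simp only [Finset.coe_Ico, Set.mem_Ico] at hi
      exact (h.pos i (by omega) (by omega)).2.2
  simp only [Nat.card_Ico] at this
  omega

/-- Everything after the entry `f 1 - 1` is smaller. -/
theorem val_lt_of_cut_lt (h : IsDoublyAltComplete M f g) (h1 : 1 < f 1) (x : ℕ)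
    (hx : g (f 1 - 1) < x) (hx' : x ≤ M) : f x < f 1 - 1 := by
  have hM := h.len
  have e1 := h.val 1 (by omega) (by omega)
  have e3 := h.pos (f 1 - 1) (by omega) (by omega)
  have e4 := h.val x (by omega) (by omega)
  by_contra hlt
  by_cases he : f x = f 1 - 1
  · rw [he] at e4; omega
  · have := h.pos_lt_cut h1 (f x) (by omega) (by omega)
    omega

/-- The part before the entry `f 1 - 1`. -/
theorem left_part (h : IsDoublyAltComplete M f g) (h1 : 1 < f 1) :
    IsDoublyAltComplete (g (f 1 - 1) - 1) (fun x => f x - (f 1 - 1))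
      (fun v => g (v + (f 1 - 1))) := by
  obtain ⟨hv, hr, hcut⟩ := h.first_cut h1
  have hM := h.len
  have e1 := h.val 1 (by omega) (by omega)
  have e3 := h.pos (f 1 - 1) (by omega) (by omega)
  have hlt := h.pos_lt_cut h1
  have hadd := h.cut_add h1
  generalize hvv : f 1 = v at *
  generalize hrr : g (v - 1) = r at *
  refine ⟨by omega, ?_, ?_, ?_, ?_, ?_, ?_, ?_, ?_⟩
  · intro x h1 h2
    have := h.val x h1 (by omega)
    have := hcut x h1 (by omega)
    rw [show f x - (v - 1) + (v - 1) = f x by omega]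
    omega
  · intro i h1 h2
    have := h.pos (i + (v - 1)) (by omega) (by omega)
    have := hlt (i + (v - 1)) (by omega) (by omega)
    omega
  · intro x h1 h2
    have := h.parity x h1 (by omega)
    have := hcut x h1 (by omega)
    omega
  · intro x h1 h2 hx
    have := h.mod_four x h1 (by omega) hx
    have := hcut x h1 (by omega)
    omega
  · intro i h1 h2 hi z hz
    have := h.pos (i + (v - 1)) (by omega) (by omega)
    have := h.pos (i + 1 + (v - 1)) (by omega) (by omega)
    have := hlt (i + (v - 1)) (by omega) (by omega)
    have := hlt (i + 1 + (v - 1)) (by omega) (by omega)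
    have e5 := h.low (i + (v - 1)) (by omega) (by omega) (by omega) z
    rw [show i + (v - 1) + 1 = i + 1 + (v - 1) by omega] at e5
    have := e5 hz
    have := hcut z (by omega) (by omega)
    omega
  · intro i h1 h2 hi z hz
    have e5 := h.high (i + (v - 1)) (by omega) (by omega) (by omega) z
    rw [show i + (v - 1) + 1 = i + 1 + (v - 1) by omega] at e5
    have := e5 hz
    omega
  · intro i h1 h2 hi
    have e5 := h.asc (i + (v - 1)) (by omega) (by omega) (by omega)
    rw [show i + (v - 1) + 1 = i + 1 + (v - 1) by omega,
      show i + (v - 1) - 1 = i - 1 + (v - 1) by omega] at e5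
    exact e5
  · intro i h1 h2 hi
    have e5 := h.desc (i + (v - 1)) (by omega) (by omega) (by omega)
    rw [show i + (v - 1) + 1 = i + 1 + (v - 1) by omega,
      show i + (v - 1) - 1 = i - 1 + (v - 1) by omega] at e5
    exact e5

/-- The part after the entry `f 1 - 1`. -/
theorem right_part (h : IsDoublyAltComplete M f g) (h1 : 1 < f 1) :
    IsDoublyAltComplete (f 1 - 2) (fun x => f (x + g (f 1 - 1)))
      (fun v => g v - g (f 1 - 1)) := by
  obtain ⟨hv, hr, hcut⟩ := h.first_cut h1
  have hM := h.len
  have e1 := h.val 1 (by omega) (by omega)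
  have e3 := h.pos (f 1 - 1) (by omega) (by omega)
  have hgt := h.val_lt_of_cut_lt h1
  have hadd := h.cut_add h1
  generalize hvv : f 1 = v at *
  generalize hrr : g (v - 1) = r at *
  have hpos : ∀ i, 1 ≤ i → i ≤ v - 2 → r < g i := by
    intro i h1 h2
    have e4 := h.pos i h1 (by omega)
    by_contra hle
    by_cases he : g i = r
    · rw [he] at e4; omega
    · have := hcut (g i) (by omega) (by omega)
      omega
  refine ⟨by omega, ?_, ?_, ?_, ?_, ?_, ?_, ?_, ?_⟩
  · intro x h1 h2
    have := h.val (x + r) (by omega) (by omega)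
    have := hgt (x + r) (by omega) (by omega)
    omega
  · intro i h1 h2
    have := h.pos i (by omega) (by omega)
    have := hpos i (by omega) (by omega)
    rw [show g i - r + r = g i by omega]
    omega
  · intro x h1 h2
    have := h.parity (x + r) (by omega) (by omega)
    omega
  · intro x h1 h2 hx
    have := h.mod_four (x + r) (by omega) (by omega) (by omega)
    omega
  · intro i h1 h2 hi z hz
    have := hpos i (by omega) (by omega)
    have := hpos (i + 1) (by omega) (by omega)
    exact h.low i (by omega) (by omega) (by omega) (z + r) (by omega)
  · intro i h1 h2 hi z hz
    have := hpos i (by omega) (by omega)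
    have := hpos (i + 1) (by omega) (by omega)
    exact h.high i (by omega) (by omega) (by omega) (z + r) (by omega)
  · intro i h1 h2 hi
    have := hpos i (by omega) (by omega)
    have := hpos (i + 1) (by omega) (by omega)
    have := hpos (i - 1) (by omega) (by omega)
    have e5 := h.asc i (by omega) (by omega) hi
    omega
  · intro i h1 h2 hi
    have := hpos i (by omega) (by omega)
    have := hpos (i + 1) (by omega) (by omega)
    have := hpos (i - 1) (by omega) (by omega)
    have e5 := h.desc i (by omega) (by omega) hi
    omega

-- Permutations beginning with 1.

theorem val_last (h : IsDoublyAltComplete M f g) (h1 : f 1 = 1) : f M = M := by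
  have hM := h.len
  have hrc := h.reverseComplement
  have eM := h.val M (by omega) (by omega)
  have eP := h.parity M (by omega) (by omega)
  by_contra hne
  -- The reverse complement ends with its maximum `M`, so its cut could only be last; by `cut_add`
  -- its first entry would then be 2, against parity.
  have h3 := hrc.val_lt_of_cut_lt (by simp; omega) M
  simp only [Nat.add_sub_cancel, Nat.add_sub_cancel_left, h1] at h3
  have h5 := hrc.cut_add (by simp; omega)
  simp only [Nat.add_sub_cancel] at h5
  omega

theorem val_two (h : IsDoublyAltComplete M f g) (h1 : f 1 = 1) : f 2 = 2 := by
  have hM := h.len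
  have e1 := h.val 1 (by omega) (by omega)
  rw [h1] at e1
  have e2 := h.pos 2 (by omega) (by omega)
  have n1 : g 2 ≠ 1 := by intro he; rw [he] at e2; omega
  have e3 := h.low 1 (by omega) (by omega) (by omega) 2
  have e4 := h.val 2 (by omega) (by omega)
  have : g 2 = 2 := by
    simp only [Nat.reduceAdd] at e3
    omega
  rw [this] at e2
  omega

theorem val_penultimate (h : IsDoublyAltComplete M f g) (h1 : f M = M) : f (M - 1) = M - 1 := by
  have hM := h.len
  have e1 := h.val M (by omega) (by omega)
  rw [h1] at e1
  have e2 := h.pos (M - 1) (by omega) (by omega)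
  have n1 : g (M - 1) ≠ M := by intro he; rw [he] at e2; omega
  have e3 := h.high (M - 1) (by omega) (by omega) (by omega) (M - 1)
  have e4 := h.val (M - 1) (by omega) (by omega)
  rw [show M - 1 + 1 = M by omega] at e3
  have : g (M - 1) = M - 1 := by omega
  rw [this] at e2
  omega

end IsDoublyAltComplete


/-! ### Words of functions -/

/-- The word `f(1) … f(n)`. -/
def word (n : ℕ) (f : ℕ → ℕ) : List ℕ := (List.range' 1 n).map f

@[simp] theorem length_word (n : ℕ) (f : ℕ → ℕ) : (word n f).length = n := by simp [word]

theorem getElem?_word {n : ℕ} {f : ℕ → ℕ} {x v : ℕ} :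
    (word n f)[x]? = some v ↔ x + 1 ≤ n ∧ f (x + 1) = v := by
  rw [word, List.getElem?_map]
  by_cases h : x < n
  · simp [h, add_comm 1 x]
  · rw [List.getElem?_eq_none (by simpa using h)]
    simp
    omega

theorem word_congr {n : ℕ} {f f' : ℕ → ℕ} (h : ∀ x, 1 ≤ x → x ≤ n → f x = f' x) :
    word n f = word n f' :=
  List.map_congr_left fun x hx => by
    simp only [List.mem_range'_1] at hx
    exact h x hx.1 (by omega)

theorem word_add (m n : ℕ) (f : ℕ → ℕ) :
    word (m + n) f = word m f ++ word n fun x => f (m + x) := by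
  rw [word, ← List.range'_append_1, List.map_append, word, word]
  congr 1
  rw [add_comm 1 m, ← List.map_add_range', List.map_map]
  rfl

theorem word_one (f : ℕ → ℕ) : word 1 f = [f 1] := rfl

theorem map_word (n : ℕ) (f φ : ℕ → ℕ) : (word n f).map φ = word n fun x => φ (f x) := by
  simp [word]

theorem isPermWord_word {n : ℕ} {f g : ℕ → ℕ}
    (h : ∀ x, 1 ≤ x → x ≤ n → 1 ≤ f x ∧ f x ≤ n ∧ g (f x) = x) : IsPermWord (word n f) := by
  rw [isPermWord_iff]
  refine ⟨List.Nodup.map_on (fun x hx y hy he => ?_) List.nodup_range', fun a ha => ?_⟩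
  · simp only [List.mem_range'_1] at hx hy
    rw [← (h x hx.1 (by omega)).2.2, he, (h y hy.1 (by omega)).2.2]
  · obtain ⟨x, hx, rfl⟩ := List.mem_map.1 ha
    simp only [List.mem_range'_1] at hx
    have := h x hx.1 (by omega)
    rw [length_word]
    omega

theorem inverse_word {n : ℕ} {f g : ℕ → ℕ}
    (h : ∀ x, 1 ≤ x → x ≤ n → 1 ≤ f x ∧ f x ≤ n ∧ g (f x) = x)
    (h' : ∀ x, 1 ≤ x → x ≤ n → 1 ≤ g x ∧ g x ≤ n ∧ f (g x) = x) :
    inverse (word n f) = word n g := by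
  have hn := (isPermWord_iff.1 (isPermWord_word h)).1
  rw [inverse, length_word]
  refine word_congr fun v hv hv' => ?_
  obtain ⟨h1, h2, h3⟩ := h' v hv hv'
  have h4 : (word n f)[g v - 1]? = some v :=
    getElem?_word.2 ⟨by omega, by rw [Nat.sub_add_cancel h1, h3]⟩
  obtain ⟨h5, h6⟩ := List.getElem?_eq_some_iff.1 h4
  have := hn.idxOf_getElem _ h5
  rw [h6] at this
  omega

theorem isAlternating_word {n : ℕ} {h : ℕ → ℕ} :
    IsAlternating (word n h) ↔ ∀ x, 1 ≤ x → x + 1 ≤ n →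
      (x % 2 = 1 → h x < h (x + 1)) ∧ (x % 2 = 0 → h (x + 1) < h x) := by
  simp only [IsAlternating, getElem?_word, Nat.even_iff, Nat.odd_iff]
  constructor
  · intro H x h1 h2
    have := H (x - 1) (h x) (h (x + 1)) ⟨by omega, by rw [Nat.sub_add_cancel h1]⟩
      ⟨by omega, by rw [Nat.sub_add_cancel h1]⟩
    exact ⟨fun hx => this.1 (by omega), fun hx => this.2 (by omega)⟩
  · rintro H x _ _ ⟨-, rfl⟩ ⟨h1, rfl⟩
    have := H (x + 1) (by omega) h1
    exact ⟨fun hx => this.1 (by omega), fun hx => this.2 (by omega)⟩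

theorem inducedOdd_word {m : ℕ} {f : ℕ → ℕ}
    (h : ∀ x, 1 ≤ x → x ≤ 2 * m + 1 → f x % 2 = x % 2) :
    inducedOdd (word (2 * m + 1) f) = word (m + 1) fun j => (f (2 * j - 1) + 1) / 2 := by
  induction m with
  | zero => simp [word, inducedOdd, h 1]
  | succ m ih =>
    rw [show 2 * (m + 1) + 1 = 2 * m + 1 + 1 + 1 by ring, word_add, word_add _ 1,
      word_add (m + 1) 1, ← ih fun x h1 h2 => h x h1 (by omega)]
    have h1 := h (2 * m + 1 + 1) (by omega) (by omega)
    have h2 := h (2 * m + 1 + 1 + 1) (by omega) (by omega)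
    rw [show (2 * m + 1 + 1) % 2 = 0 by omega] at h1
    rw [show (2 * m + 1 + 1 + 1) % 2 = 1 by omega] at h2
    simp [inducedOdd, List.filter_append, word_one, h1, h2,
      show 2 * (m + 1 + 1) - 1 = 2 * m + 1 + 1 + 1 by omega]

theorem length_filter_range' (n : ℕ) :
    ((List.range' 1 n).filter fun v => v % 2 = 0).length = n / 2 ∧
      ((List.range' 1 n).filter fun v => v % 2 = 1).length = (n + 1) / 2 := by
  induction n with
  | zero => simp
  | succ n ih =>
    rw [List.range'_concat, List.filter_append, List.filter_append, List.length_append,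
      List.length_append, ih.1, ih.2]
    rcases Nat.mod_two_eq_zero_or_one (1 + n) with h | h <;> simp [h] <;> omega

theorem IsPermWord.length_inducedEven {w : List ℕ} (h : IsPermWord w) :
    (inducedEven w).length = w.length / 2 := by
  rw [inducedEven, List.length_map, (h.filter _).length_eq, (length_filter_range' _).1]

theorem IsPermWord.length_inducedOdd {w : List ℕ} (h : IsPermWord w) :
    (inducedOdd w).length = (w.length + 1) / 2 := by
  rw [inducedOdd, List.length_map, (h.filter _).length_eq, (length_filter_range' _).2]

/-! ### Complete Baxter permutations as pairs of functions -/

/-- `f` is a complete Baxter permutation of `{1, …, M}` with inverse `g`. -/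
structure IsCompletePair (M : ℕ) (f g : ℕ → ℕ) : Prop where
  len : M % 2 = 1
  val : ∀ x, 1 ≤ x → x ≤ M → 1 ≤ f x ∧ f x ≤ M ∧ g (f x) = x
  pos : ∀ v, 1 ≤ v → v ≤ M → 1 ≤ g v ∧ g v ≤ M ∧ f (g v) = v
  parity : ∀ x, 1 ≤ x → x ≤ M → f x % 2 = x % 2
  low : ∀ i, 1 ≤ i → i + 1 ≤ M → i % 2 = 1 → ∀ z,
    (g i < z ∧ z < g (i + 1) ∨ g (i + 1) < z ∧ z < g i) → f z < i
  high : ∀ i, 1 ≤ i → i + 1 ≤ M → i % 2 = 0 → ∀ z,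
    (g i < z ∧ z < g (i + 1) ∨ g (i + 1) < z ∧ z < g i) → i + 1 < f z

theorem IsDoublyAltComplete.isCompletePair {M : ℕ} {f g : ℕ → ℕ}
    (h : IsDoublyAltComplete M f g) : IsCompletePair M f g :=
  ⟨by have := h.len; omega, h.val, h.pos, h.parity, h.low, h.high⟩

namespace IsCompletePair

variable {M : ℕ} {f g : ℕ → ℕ}

theorem isCompleteBaxter (h : IsCompletePair M f g) : IsCompleteBaxter (word M f) where
  isPermWord := isPermWord_word h.val
  odd_length := by rw [length_word]; exact Nat.odd_iff.2 h.len
  parity x v hv := by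
    obtain ⟨h1, rfl⟩ := getElem?_word.1 hv
    rw [Nat.even_iff, Nat.even_iff, h.parity _ (by omega) h1]
  between i x y z v hx hy hz hb := by
    obtain ⟨h1, rfl⟩ := getElem?_word.1 hx
    obtain ⟨h2, h3⟩ := getElem?_word.1 hy
    obtain ⟨h4, rfl⟩ := getElem?_word.1 hz
    have e1 := h.val (x + 1) (by omega) h1
    have e2 := h.val (y + 1) (by omega) h2
    rw [h3] at e2
    rw [Nat.odd_iff, Nat.even_iff]
    exact ⟨fun hi => h.low _ e1.1 e2.2.1 hi _ (by omega),
      fun hi => h.high _ e1.1 e2.2.1 hi _ (by omega)⟩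

/-- By `low`, `i + 1` is not between `i - 1` and `i`; by `high`, `i - 1` is not between `i` and `i +
1`. So `i` is in the middle, and its neighbours in position fall under the same two conditions. -/
theorem asc_spec (h : IsCompletePair M f g) {i : ℕ} (h1 : 1 ≤ i) (h2 : i ≤ M) (hi : i % 2 = 0)
    (hlt : g (i - 1) < g (i + 1)) :
    (g (i - 1) < g i ∧ g i < g (i + 1)) ∧ f (g i - 1) < i ∧ i < f (g i + 1) := by
  have hM := h.len
  have e1 := h.pos (i - 1) (by omega) (by omega)
  have e2 := h.pos i (by omega) (by omega)
  have e3 := h.pos (i + 1) (by omega) (by omega)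
  have l := h.low (i - 1) (by omega) (by omega) (by omega)
  have u := h.high i (by omega) (by omega) hi
  rw [show i - 1 + 1 = i by omega] at l
  have n1 : g (i - 1) ≠ g i := by intro he; rw [he] at e1; omega
  have n2 : g (i + 1) ≠ g i := by intro he; rw [he] at e3; omega
  have l1 := l (g (i + 1))
  have u1 := u (g (i - 1))
  have l2 := l (g i - 1)
  have u2 := u (g i + 1)
  have hord : g (i - 1) < g i ∧ g i < g (i + 1) := by omega
  refine ⟨hord, ?_, ?_⟩
  · by_cases he : g i - 1 = g (i - 1)
    · rw [he]; omega
    · omega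
  · by_cases he : g i + 1 = g (i + 1)
    · rw [he]; omega
    · omega

theorem desc_spec (h : IsCompletePair M f g) {i : ℕ} (h1 : 1 ≤ i) (h2 : i ≤ M) (hi : i % 2 = 0)
    (hlt : g (i + 1) < g (i - 1)) :
    (g (i + 1) < g i ∧ g i < g (i - 1)) ∧ f (g i + 1) < i ∧ i < f (g i - 1) := by
  have hM := h.len
  have e1 := h.pos (i - 1) (by omega) (by omega)
  have e2 := h.pos i (by omega) (by omega)
  have e3 := h.pos (i + 1) (by omega) (by omega)
  have l := h.low (i - 1) (by omega) (by omega) (by omega)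
  have u := h.high i (by omega) (by omega) hi
  rw [show i - 1 + 1 = i by omega] at l
  have n1 : g (i - 1) ≠ g i := by intro he; rw [he] at e1; omega
  have n2 : g (i + 1) ≠ g i := by intro he; rw [he] at e3; omega
  have l1 := l (g (i + 1))
  have u1 := u (g (i - 1))
  have l2 := l (g i + 1)
  have u2 := u (g i - 1)
  have hord : g (i + 1) < g i ∧ g i < g (i - 1) := by omega
  refine ⟨hord, ?_, ?_⟩
  · by_cases he : g i + 1 = g (i - 1)
    · rw [he]; omega
    · omega
  · by_cases he : g i - 1 = g (i + 1)
    · rw [he]; omega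
    · omega

theorem isDoublyAlternating_iff (h : IsCompletePair M f g) :
    IsDoublyAlternating (inducedOdd (word M f)) ↔
      (∀ z, 1 ≤ z → z ≤ M → (z % 4 = 2 → f (z - 1) < f (z + 1)) ∧
        (z % 4 = 0 → f (z + 1) < f (z - 1))) ∧
      ∀ z, 1 ≤ z → z ≤ M → (z % 4 = 2 → g (z - 1) < g (z + 1)) ∧
        (z % 4 = 0 → g (z + 1) < g (z - 1)) := by
  obtain ⟨m, rfl⟩ : ∃ m, M = 2 * m + 1 := ⟨M / 2, by have := h.len; omega⟩
  have hg2 : ∀ v, 1 ≤ v → v ≤ 2 * m + 1 → g v % 2 = v % 2 := by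
    intro v h1 h2
    have e1 := h.pos v h1 h2
    have e2 := h.parity (g v) e1.1 e1.2.1
    rw [e1.2.2] at e2
    exact e2.symm
  have aux : ∀ f : ℕ → ℕ, (∀ x, 1 ≤ x → x ≤ 2 * m + 1 → f x % 2 = x % 2) →
      (IsAlternating (word (m + 1) fun j => (f (2 * j - 1) + 1) / 2) ↔
        ∀ z, 1 ≤ z → z ≤ 2 * m + 1 → (z % 4 = 2 → f (z - 1) < f (z + 1)) ∧
        (z % 4 = 0 → f (z + 1) < f (z - 1))) := by
    intro f hf
    rw [isAlternating_word]
    constructor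
    · intro H z h1 h2
      constructor
      · intro hz
        have e1 := (H (z / 2) (by omega) (by omega)).1 (by omega)
        rw [show 2 * (z / 2) - 1 = z - 1 by omega, show 2 * (z / 2 + 1) - 1 = z + 1 by omega] at e1
        omega
      · intro hz
        have e1 := (H (z / 2) (by omega) (by omega)).2 (by omega)
        rw [show 2 * (z / 2) - 1 = z - 1 by omega, show 2 * (z / 2 + 1) - 1 = z + 1 by omega] at e1
        omega
    · intro H x h1 h2
      have e1 := H (2 * x) (by omega) (by omega)
      have e2 := hf (2 * x - 1) (by omega) (by omega)
      have e3 := hf (2 * x + 1) (by omega) (by omega)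
      rw [show 2 * (x + 1) - 1 = 2 * x + 1 by omega]
      omega
  rw [IsDoublyAlternating, inducedOdd_word h.parity, inverse_word
    (g := fun j => (g (2 * j - 1) + 1) / 2), aux f h.parity, aux g hg2]
  · intro j h1 h2
    have e1 := h.val (2 * j - 1) (by omega) (by omega)
    have e2 := h.parity (2 * j - 1) (by omega) (by omega)
    have : 2 * ((f (2 * j - 1) + 1) / 2) - 1 = f (2 * j - 1) := by omega
    rw [this]
    omega
  · intro j h1 h2
    have e1 := h.pos (2 * j - 1) (by omega) (by omega)
    have e2 := hg2 (2 * j - 1) (by omega) (by omega)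
    have : 2 * ((g (2 * j - 1) + 1) / 2) - 1 = g (2 * j - 1) := by omega
    rw [this]
    omega

/-- An even entry sits at an ascent of positions exactly when it is an ascent of values. Alternation
in both directions reads these off as residues modulo 4, which gives `mod_four`. -/
theorem isDoublyAltComplete (h : IsCompletePair M f g) (hM : M % 4 = 3)
    (ha : IsDoublyAlternating (inducedOdd (word M f))) : IsDoublyAltComplete M f g := by
  obtain ⟨hf, hg⟩ := h.isDoublyAlternating_iff.1 ha
  refine ⟨hM, h.val, h.pos, h.parity, ?_, h.low, h.high, ?_, ?_⟩
  · intro z h1 h2 hz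
    have e1 := h.val z h1 h2
    have e2 := h.parity z h1 h2
    have e3 := hf z h1 h2
    have e4 := hg (f z) (by omega) (by omega)
    by_cases h4 : f z % 4 = 2
    · have := h.asc_spec e1.1 e1.2.1 (by omega) (e4.1 h4)
      rw [e1.2.2] at this
      omega
    · have := h.desc_spec e1.1 e1.2.1 (by omega) (e4.2 (by omega))
      rw [e1.2.2] at this
      omega
  · intro i h1 h2 hi
    exact (h.asc_spec h1 h2 (by omega) ((hg i h1 h2).1 hi)).1
  · intro i h1 h2 hi
    exact (h.desc_spec h1 h2 (by omega) ((hg i h1 h2).2 hi)).1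

end IsCompletePair

theorem IsDoublyAltComplete.isDoublyAlternating {M : ℕ} {f g : ℕ → ℕ}
    (h : IsDoublyAltComplete M f g) : IsDoublyAlternating (inducedOdd (word M f)) := by
  have hp := h.isCompletePair
  have hM := h.len
  refine hp.isDoublyAlternating_iff.2 ⟨fun z h1 h2 => ?_, fun z h1 h2 => ?_⟩
  · have e1 := h.val z h1 h2
    have e2 := h.mod_four z h1 h2
    refine ⟨fun hz => ?_, fun hz => ?_⟩
    · have e3 := h.asc (f z) e1.1 e1.2.1 (by omega)
      have e4 := hp.asc_spec e1.1 e1.2.1 (by omega) (by omega)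
      rw [e1.2.2] at e4
      omega
    · have e3 := h.desc (f z) e1.1 e1.2.1 (by omega)
      have e4 := hp.desc_spec e1.1 e1.2.1 (by omega) (by omega)
      rw [e1.2.2] at e4
      omega
  · refine ⟨fun hz => ?_, fun hz => ?_⟩
    · have := h.asc z h1 h2 hz; omega
    · have := h.desc z h1 h2 hz; omega

theorem IsCompleteBaxter.exists_isCompletePair {w : List ℕ} (h : IsCompleteBaxter w) :
    ∃ f g, IsCompletePair w.length f g ∧ w = word w.length f := by
  obtain ⟨hn, hb⟩ := isPermWord_iff.1 h.isPermWord
  -- Positions are shifted to start at 1; the default 0 is never read for `1 ≤ x ≤ w.length`.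
  let f : ℕ → ℕ := fun x => w.getD (x - 1) 0
  let g : ℕ → ℕ := fun v => w.idxOf v + 1
  have hfx : ∀ x, 1 ≤ x → x ≤ w.length → w[x - 1]? = some (f x) := by
    intro x h1 h2
    simp only [f]
    rw [List.getElem?_eq_getElem (by omega), List.getD_eq_getElem _ _ (by omega)]
  have hmem : ∀ v, 1 ≤ v → v ≤ w.length → v ∈ w := by
    intro v h1 h2
    rw [h.isPermWord.mem_iff]
    simp
    omega
  have hval : ∀ x, 1 ≤ x → x ≤ w.length → 1 ≤ f x ∧ f x ≤ w.length ∧ g (f x) = x := by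
    intro x h1 h2
    have e1 := hfx x h1 h2
    have e2 := hb _ (List.mem_of_getElem? e1)
    refine ⟨e2.1, e2.2, ?_⟩
    obtain ⟨h3, h4⟩ := List.getElem?_eq_some_iff.1 e1
    have := hn.idxOf_getElem _ h3
    rw [h4] at this
    simp only [g, this]
    omega
  have hpos : ∀ v, 1 ≤ v → v ≤ w.length → 1 ≤ g v ∧ g v ≤ w.length ∧ f (g v) = v := by
    intro v h1 h2
    have e1 := List.idxOf_lt_length_of_mem (hmem v h1 h2)
    refine ⟨by simp [g], e1, ?_⟩
    simp only [f, g, Nat.add_sub_cancel]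
    rw [List.getD_eq_getElem _ _ e1, List.getElem_idxOf e1]
  have hbet : ∀ i, 1 ≤ i → i + 1 ≤ w.length → ∀ z,
      (g i < z ∧ z < g (i + 1) ∨ g (i + 1) < z ∧ z < g i) →
        (Odd i → f z < i) ∧ (Even i → i + 1 < f z) := by
    intro i h1 h2 z hz
    have e1 := hpos i (by omega) (by omega)
    have e2 := hpos (i + 1) (by omega) (by omega)
    have e3 := hfx (g i) e1.1 e1.2.1
    have e4 := hfx (g (i + 1)) e2.1 e2.2.1
    rw [e1.2.2] at e3
    rw [e2.2.2] at e4
    exact h.between i _ _ _ _ e3 e4 (hfx z (by omega) (by omega)) (by omega)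
  refine ⟨f, g, ⟨Nat.odd_iff.1 h.odd_length, hval, hpos, ?_, ?_, ?_⟩, ?_⟩
  · intro x h1 h2
    have := h.parity _ _ (hfx x h1 h2)
    rw [Nat.sub_add_cancel h1, Nat.even_iff, Nat.even_iff] at this
    omega
  · intro i h1 h2 hi z hz
    exact (hbet i h1 h2 z hz).1 (Nat.odd_iff.2 hi)
  · intro i h1 h2 hi z hz
    exact (hbet i h1 h2 z hz).2 (Nat.even_iff.2 hi)
  · refine List.ext_getElem (by simp) fun n h1 h2 => ?_
    have e1 := hfx (n + 1) (by omega) (by omega)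
    simp only [Nat.add_sub_cancel] at e1
    rw [List.getElem?_eq_getElem h1, Option.some.injEq] at e1
    rw [e1]
    symm
    apply Option.some.inj
    rw [← List.getElem?_eq_getElem h2]
    exact getElem?_word.2 ⟨by omega, rfl⟩

/-! ### The complete Baxter permutations of snow leopard permutations -/

/-- `1 ⊕ 1 ⊕ c(x) ⊕ 1 ⊕ 1`. -/
def doubleArch : GPerm → List ℕ
  | .anti => [1, 2, 3]
  | .perm w => 1 :: 2 :: ((comp w).map (fun a => 2 + a) ++ [w.length + 3, w.length + 4])

/-- The complete Baxter permutation with even part `BinTree.snow`. -/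
def BinTree.full : BinTree → GPerm
  | leaf => .anti
  | node a b => .perm (skew (doubleArch (full a)) (lid (full b)))

/-- Either `@` or a complete Baxter permutation with doubly alternating odd part. -/
def IsDoublyAltWord (x : GPerm) : Prop :=
  x = .anti ∨ ∃ M f g, IsDoublyAltComplete M f g ∧ x = .perm (word M f)

theorem word_doubleArch {M : ℕ} {f f' : ℕ → ℕ} 
    (hf : ∀ x, 1 ≤ x → x ≤ 2 ∨ M + 3 ≤ x → x ≤ M + 4 → f' x = x)
    (hf' : ∀ y, 1 ≤ y → y ≤ M → f' (2 + y) = 2 + (M + 1 - f y)) :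
    word (M + 4) f' = doubleArch (.perm (word M f)) := by
  rw [show M + 4 = 1 + (1 + (M + (1 + 1))) by ring, word_add, word_add, word_add, word_add]
  simp only [word_one, doubleArch, length_word, comp, map_word]
  rw [hf 1 (by omega) (by omega) (by omega), hf (1 + 1) (by omega) (by omega) (by omega),
    hf (1 + (1 + (M + 1))) (by omega) (by omega) (by omega),
    hf (1 + (1 + (M + (1 + 1)))) (by omega) (by omega) (by omega)]
  have h : (word M fun x => f' (1 + (1 + x))) = word M fun x => 2 + (M + 1 - f x) :=
    word_congr fun x h1 h2 => by rw [← hf' x h1 h2]; congr 1; omega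
  rw [h]
  simp
  omega

theorem IsDoublyAltWord.doubleArch {x : GPerm} (h : IsDoublyAltWord x) :
    ∃ M f g, IsDoublyAltComplete M f g ∧ doubleArch x = word M f := by
  rcases h with rfl | ⟨M, f, g, h, rfl⟩
  · exact ⟨3, id, id, isDoublyAltComplete_three, rfl⟩
  · refine ⟨M + 4, fun x => if x ≤ 2 ∨ M + 3 ≤ x then x else M + 3 - f (x - 2),
      fun v => if v ≤ 2 ∨ M + 3 ≤ v then v else g (M + 3 - v) + 2, h.arch ?_ ?_ ?_ ?_, ?_⟩
    · intro x hx; simp only [if_pos hx]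
    · rintro x y rfl h1 h2
      rw [if_neg (by omega), Nat.add_sub_cancel]
    · intro x hx; simp only [if_pos hx]
    · rintro v u hvu h1 h2
      rw [if_neg (by omega), show M + 3 - v = u by omega]
    · refine (word_doubleArch (fun x _ hx _ => if_pos hx) fun y h1 h2 => ?_).symm
      have := h.val y h1 h2
      rw [if_neg (by omega), Nat.add_sub_cancel_left]
      omega

theorem word_skew {p q : ℕ} {f₁ f₂ f' : ℕ → ℕ}
    (hf₁ : ∀ x, 1 ≤ x → x ≤ p → f' x = q + 1 + f₁ x) (hf : f' (p + 1) = q + 1)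
    (hf₂ : ∀ y, 1 ≤ y → y ≤ q → f' (p + 1 + y) = f₂ y) :
    word (p + 1 + q) f' = skew (word p f₁) (lid (.perm (word q f₂))) := by
  rw [word_add, word_add, word_one, hf, word_congr hf₁, word_congr hf₂, skew, map_word]
  simp [lid]

theorem IsDoublyAltWord.skew {M : ℕ} {f g : ℕ → ℕ} {y : GPerm}
    (hx : IsDoublyAltComplete M f g) (hy : IsDoublyAltWord y) :
    IsDoublyAltWord (.perm (skew (word M f) (lid y))) := by
  rcases hy with rfl | ⟨q, f₂, g₂, h, rfl⟩
  · exact .inr ⟨M, f, g, hx, by simp [lid]⟩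
  · refine .inr ⟨M + 1 + q,
      fun x => if x ≤ M then f x + (q + 1) else if x = M + 1 then q + 1 else f₂ (x - (M + 1)),
      fun v => if v ≤ q then g₂ v + (M + 1) else if v = q + 1 then M + 1 else g (v - (q + 1)),
      hx.skew h ?_ ?_ ?_ ?_ ?_ ?_, ?_⟩
    · intro x h1 h2; rw [if_pos h2]
    · simp
    · rintro x y rfl h1 h2
      rw [if_neg (by omega), if_neg (by omega), Nat.add_sub_cancel]
    · intro x h1 h2; rw [if_pos h2]
    · simp
    · rintro x y rfl h1 h2
      rw [if_neg (by omega), if_neg (by omega), Nat.add_sub_cancel]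
    · rw [word_skew (f₁ := f) (f₂ := f₂)]
      · intro x h1 h2; rw [if_pos h2, add_comm]
      · simp
      · intro y h1 h2
        rw [if_neg (by omega), if_neg (by omega), Nat.add_sub_cancel_left]

theorem isDoublyAltWord_full (t : BinTree) : IsDoublyAltWord t.full := by
  induction t with
  | leaf => exact .inl rfl
  | node a b iha ihb =>
    obtain ⟨M, f, g, h, he⟩ := iha.doubleArch
    rw [BinTree.full, he]
    exact .skew h ihb

/-- The induction hypothesis is an argument so that this serves both for a whole permutation
beginning with 1 and for the left part of a cut. -/
theorem IsDoublyAltComplete.exists_doubleArch {M : ℕ} {f g : ℕ → ℕ}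
    (h : IsDoublyAltComplete M f g) (h1 : f 1 = 1)
    (ih : ∀ N < M, ∀ f g, IsDoublyAltComplete N f g → ∃ t : BinTree, t.full = .perm (word N f)) :
    ∃ t : BinTree, doubleArch t.full = word M f := by
  have hM := h.len
  have h2 := h.val_two h1
  have h3 := h.val_last h1
  have h4 := h.val_penultimate h3
  rcases Nat.lt_or_ge M 4 with hlt | hge
  · obtain rfl : M = 3 := by omega
    exact ⟨.leaf, by simp [BinTree.full, doubleArch, word, List.range', h1, h2, h3]⟩
  · obtain ⟨N, rfl⟩ : ∃ N, M = N + 4 := ⟨M - 4, by omega⟩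
    have hi := h.of_arch (by omega) h1 h2 h4 h3
    obtain ⟨t, ht⟩ := ih N (by omega) _ _ hi
    refine ⟨t, ?_⟩
    rw [ht]
    refine (word_doubleArch (fun x hx0 hx hx' => ?_) fun y h1 h2 => ?_).symm
    · have : x = 1 ∨ x = 2 ∨ x = N + 3 ∨ x = N + 4 := by omega
      rcases this with rfl | rfl | rfl | rfl <;> assumption
    · have := hi.val y h1 h2
      rw [add_comm 2 y]
      omega

theorem IsDoublyAltComplete.exists_full {M : ℕ} {f g : ℕ → ℕ} (h : IsDoublyAltComplete M f g) :
    ∃ t : BinTree, t.full = .perm (word M f) := by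
  induction M using Nat.strong_induction_on generalizing f g with
  | _ M ih =>
  have hM := h.len
  have e1 := h.val 1 (by omega) (by omega)
  rcases Nat.eq_or_lt_of_le e1.1 with h1 | h1
  · obtain ⟨t, ht⟩ := h.exists_doubleArch h1.symm fun N hN f g => ih N hN
    exact ⟨.node t .leaf, by simp [BinTree.full, lid, ht]⟩
  · have e2 := h.pos (f 1 - 1) (by omega) (by omega)
    have e3 := h.first_cut h1
    have e4 := h.cut_add h1
    obtain ⟨a, ha⟩ := (h.left_part h1).exists_doubleArch (by omega)
      fun N hN f g => ih N (by omega)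
    obtain ⟨b, hb⟩ := ih _ (by omega) (h.right_part h1)
    refine ⟨.node a b, ?_⟩
    rw [BinTree.full, ha, hb, ← word_skew (f' := f)]
    · congr 2; omega
    · intro x hx hx'
      have := e3.2.2 x hx (by omega)
      omega
    · rw [Nat.sub_add_cancel e2.1]; omega
    · intro y hy hy'
      rw [Nat.sub_add_cancel e2.1, add_comm]


/-! ### The direct path as a bijection -/

theorem JanusBuilt.directPath_spec {x : GPerm} (hx : JanusBuilt x) :
    IsMotzkin (directPath x) ∧ IsPeakless (directPath x) ∧
      ((directPath x).length : ℤ) = x.length + 1 := by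
  induction hx with
  | anti => exact ⟨isMotzkin_nil, by simp [isPeakless_iff, directPath], rfl⟩
  | @level x hx ih =>
    rw [directPath_lid, isMotzkin_level, isPeakless_level]
    refine ⟨ih.1, ih.2.1, ?_⟩
    rw [List.length_cons, Nat.cast_succ, ih.2.2]
    cases x <;> simp [GPerm.length, lid]
  | @up u x hu hx ihu ihx =>
    rw [directPath_up u x hu.valid ihu.1.evenTurns, isMotzkin_up ihu.1, isPeakless_up ihu.1]
    obtain ⟨-, h2, h3⟩ := ihu
    obtain ⟨h4, h5, h6⟩ := ihx
    refine ⟨h4, ⟨?_, h2, h5⟩, ?_⟩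
    · intro h
      rw [h] at h3
      simp [GPerm.length] at h3
      omega
    · simp only [List.length_cons, List.length_append]
      push_cast
      rw [h3, ← add_assoc, h6]
      cases x <;> simp [GPerm.length, lid, arch]; ring

theorem JanusBuilt.directPath_up {u : List ℕ} {x : GPerm} (hu : JanusBuilt (.perm u)) :
    directPath (.perm (skew (arch (.perm u)) (lid x))) =
      .U :: (directPath (.perm u) ++ .D :: directPath x) :=
  Janus.directPath_up u x hu.valid hu.directPath_spec.1.evenTurns

/-- The first step reveals the constructor, and `append_D_inj` separates the two subpaths. -/
theorem JanusBuilt.directPath_inj {x y : GPerm} (hx : JanusBuilt x) (hy : JanusBuilt y)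
    (h : directPath x = directPath y) : x = y := by
  induction hx generalizing y with
  | anti =>
    cases hy with
    | anti => rfl
    | level hy => rw [directPath_lid] at h; simp [directPath] at h
    | up hu hy => rw [hu.directPath_up] at h; simp [directPath] at h
  | level hx ih =>
    cases hy with
    | anti => rw [directPath_lid] at h; simp [directPath] at h
    | level hy =>
      rw [directPath_lid, directPath_lid, List.cons.injEq] at h
      rw [ih hy h.2]
    | up hu hy => rw [directPath_lid, hu.directPath_up] at h; simp at h
  | up hu hx ihu ihx =>
    cases hy with
    | anti => rw [hu.directPath_up] at h; simp [directPath] at h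
    | level hy => rw [directPath_lid, hu.directPath_up] at h; simp at h
    | up hu' hy =>
      rw [hu.directPath_up, hu'.directPath_up, List.cons.injEq] at h
      obtain ⟨h1, h2⟩ :=
        hu.directPath_spec.1.append_D_inj hu'.directPath_spec.1 h.2
      have h3 := ihu hu' h1
      rw [GPerm.perm.injEq] at h3
      rw [h3, ihx hy h2]

theorem exists_directPath_eq {p : List Step} (hp : IsMotzkin p) (hq : IsPeakless p) :
    ∃ x, JanusBuilt x ∧ directPath x = p := by
  induction hn : p.length using Nat.strong_induction_on generalizing p with
  | _ n ih =>
  subst hn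
  match p with
  | [] => exact ⟨.anti, .anti, rfl⟩
  | .L :: p =>
    obtain ⟨x, hx, rfl⟩ :=
      ih p.length (by simp) (isMotzkin_level.1 hp) (isPeakless_level.1 hq) rfl
    exact ⟨_, .level hx, directPath_lid x⟩
  | .D :: p =>
    have := hp.1 1
    simp [Step.rise] at this
  | .U :: p =>
    obtain ⟨p₁, p₂, rfl, h1⟩ := exists_first_return p p.length (by
      have := hp.2
      simp [Step.rise] at this ⊢
      omega)
    rw [isMotzkin_up h1] at hp
    rw [isPeakless_up h1] at hq
    obtain ⟨x, hx, rfl⟩ := ih p₂.length (by simp; omega) hp hq.2.2 rfl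
    obtain ⟨y, hy, rfl⟩ := ih p₁.length (by simp) h1 hq.2.1 rfl
    cases y with
    -- An empty inner path would be a peak, so the inner thread has nonnegative length.
    | anti => exact absurd rfl hq.1
    | perm u => exact ⟨_, .up hy hx, hy.directPath_up⟩

theorem isRecursiveBijection_directPath (hJ : ∀ g, IsJanusThread g ↔ JanusBuilt g) :
    IsRecursiveBijection fun g => directPath g.1 where
  bijOn n _ := by
    refine ⟨fun g hg => ?_, fun g _ g' _ h => ?_, fun p hp => ?_⟩
    · obtain ⟨h1, h2, h3⟩ := ((hJ _).1 g.2).directPath_spec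
      exact ⟨by rw [h3, hg], h1, h2⟩
    · exact Subtype.ext (((hJ _).1 g.2).directPath_inj ((hJ _).1 g'.2) h)
    · obtain ⟨x, hx, rfl⟩ := exists_directPath_eq hp.2.1 hp.2.2
      refine ⟨⟨x, (hJ x).2 hx⟩, ?_, rfl⟩
      have h1 := hx.directPath_spec.2.2
      have h2 := hp.1
      simp only [JT, Set.mem_ofPred_eq]
      omega
  map_anti g hg := by simp [hg, directPath]
  map_empty g hg := by simp [hg, directPath]
  map_level g g₁ hg := by
    simp only [hg, one_skewSum, directPath_lid]
  map_up g g₁ g₂ h hg := by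
    simp only [hg, arch_skewSum]
    obtain ⟨x, hx⟩ := g₁
    cases x with
    | anti => simp [GPerm.length] at h
    | perm u => exact ((hJ _).1 hx).directPath_up

theorem IsRecursiveBijection.eq_directPath (hJ : ∀ g, IsJanusThread g ↔ JanusBuilt g)
    {K : JanusThread → List Step} (hK : IsRecursiveBijection K) (g : JanusThread) :
    directPath g.1 = K g := by
  obtain ⟨x, hx⟩ := g
  have hb := (hJ x).1 hx
  induction hb with
  | anti => exact (hK.map_anti _ rfl).symm
  | @level x hb ih =>
    rw [hK.map_level _ ⟨x, (hJ x).2 hb⟩ (one_skewSum x).symm, ← ih, directPath_lid]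
  | @up u x hu hb ihu ih =>
    rw [hK.map_up _ ⟨.perm u, (hJ _).2 hu⟩ ⟨x, (hJ x).2 hb⟩ (by simp [GPerm.length])
      (arch_skewSum _ x).symm, ← ih, ← ihu]
    exact hu.directPath_up


/-! ### Induced permutations -/

theorem map_filter_map {p q : ℕ → Bool} {φ ψ ψ' χ : ℕ → ℕ} {w : List ℕ}
    (h : ∀ a ∈ w, q (φ a) = p a) (h' : ∀ a ∈ w, p a = true → ψ (φ a) = χ (ψ' a)) :
    ((w.map φ).filter q).map ψ = ((w.filter p).map ψ').map χ := by
  rw [List.filter_map, List.filter_congr (q := p) fun a ha => by simpa using h a ha,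
    List.map_map, List.map_map]
  refine List.map_congr_left fun a ha => ?_
  obtain ⟨h1, h2⟩ := List.mem_filter.1 ha
  exact h' a h1 h2

theorem inducedEven_skew (u : List ℕ) {v : List ℕ} (hv : IsPermWord v) (h : v.length % 2 = 0) :
    inducedEven (skew u v) = skew (inducedEven u) (inducedEven v) := by
  have hl := hv.length_inducedEven
  rw [skew, skew, hl]
  unfold inducedEven
  rw [List.filter_append, List.map_append]
  congr 1
  refine map_filter_map (fun a _ => ?_) fun a _ ha => ?_
  · exact decide_eq_decide.2 (by omega)
  · simp only [decide_eq_true_eq] at ha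
    omega

theorem inducedOdd_skew (u : List ℕ) {v : List ℕ} (hv : IsPermWord v) (h : v.length % 2 = 0) :
    inducedOdd (skew u v) = skew (inducedOdd u) (inducedOdd v) := by
  have hl := hv.length_inducedOdd
  rw [skew, skew, hl]
  unfold inducedOdd
  rw [List.filter_append, List.map_append]
  congr 1
  refine map_filter_map (fun a _ => ?_) fun a _ ha => ?_
  · exact decide_eq_decide.2 (by omega)
  · simp only [decide_eq_true_eq] at ha
    omega

/-- A permutation of odd length (possibly `@`). -/
def GPerm.OddPerm (x : GPerm) : Prop := x.Valid ∧ Odd x.length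

theorem oddPerm_perm {w : List ℕ} :
    (GPerm.perm w).OddPerm ↔ IsPermWord w ∧ w.length % 2 = 1 := by
  rw [GPerm.OddPerm, GPerm.Valid, GPerm.length, Int.odd_coe_nat, Nat.odd_iff]

theorem inducedEven_lid {x : GPerm} (hx : x.OddPerm) :
    inducedEven (lid x) = lid x.evenPart := by
  cases x with
  | anti => rfl
  | perm w =>
    obtain ⟨h1, h2⟩ := oddPerm_perm.1 hx
    have hl := h1.length_inducedEven
    rw [lid, GPerm.evenPart, lid, hl, inducedEven, List.filter_cons,
      if_pos (by simp; omega), List.map_cons, inducedEven]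
    congr 1
    omega

theorem inducedOdd_lid {x : GPerm} (hx : x.OddPerm) :
    GPerm.perm (inducedOdd (lid x)) = x.oddPart := by
  cases x with
  | anti => rfl
  | perm w =>
    obtain ⟨h1, h2⟩ := oddPerm_perm.1 hx
    rw [lid, GPerm.oddPart, inducedOdd, List.filter_cons, if_neg (by simp; omega), inducedOdd]

/-- For odd length a single arch exchanges the parities of the inner entries, so the odd part
appears, complemented; a double arch preserves parities. -/
theorem inducedEven_arch {x : GPerm} (hx : x.OddPerm) {v : List ℕ} (hv : x.oddPart = .perm v) :
    inducedEven (arch x) = comp v := by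
  cases x with
  | anti => cases hv; rfl
  | perm w =>
    cases hv
    obtain ⟨h1, h2⟩ := oddPerm_perm.1 hx
    have hb := (isPermWord_iff.1 h1).2
    have hl := h1.length_inducedOdd
    rw [comp, hl, arch, inducedEven, List.filter_cons, if_neg (by simp), List.filter_append,
      List.filter_cons, if_neg (by simp; omega), List.filter_nil, List.append_nil, comp, List.map_map,
      inducedOdd]
    refine map_filter_map (fun a ha => ?_) fun a ha ha' => ?_
    · have := hb a ha
      simp only [Function.comp_apply]
      exact decide_eq_decide.2 (by omega)
    · have := hb a ha
      simp only [decide_eq_true_eq] at ha'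
      simp only [Function.comp_apply]
      omega

theorem inducedOdd_arch {x : GPerm} (hx : x.OddPerm) :
    inducedOdd (arch x) = arch x.evenPart := by
  cases x with
  | anti => rfl
  | perm w =>
    obtain ⟨h1, h2⟩ := oddPerm_perm.1 hx
    have hb := (isPermWord_iff.1 h1).2
    have hl := h1.length_inducedEven
    rw [GPerm.evenPart, arch, arch, hl, inducedOdd, List.filter_cons, if_pos (by simp),
      List.filter_append, List.filter_cons, if_pos (by simp; omega), List.filter_nil, List.map_cons,
      List.map_append, comp, comp, hl, List.map_map, List.map_map, inducedEven]
    congr 2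
    · refine map_filter_map (fun a ha => ?_) fun a ha ha' => ?_
      · have := hb a ha
        simp only [Function.comp_apply]
        exact decide_eq_decide.2 (by omega)
      · have := hb a ha
        simp only [decide_eq_true_eq] at ha'
        simp only [Function.comp_apply]
        omega
    · simp; omega

theorem inducedEven_doubleArch {x : GPerm} (hx : x.OddPerm) :
    inducedEven (doubleArch x) = arch x.evenPart := by
  cases x with
  | anti => rfl
  | perm w =>
    obtain ⟨h1, h2⟩ := oddPerm_perm.1 hx
    have hb := (isPermWord_iff.1 h1).2
    have hl := h1.length_inducedEven
    have hf : List.filter (fun v => decide (v % 2 = 0)) [w.length + 3, w.length + 4] =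
        [w.length + 3] := by
      rw [List.filter_cons, if_pos (by simp; omega), List.filter_cons,
        if_neg (by simp; omega), List.filter_nil]
    rw [GPerm.evenPart, arch, doubleArch, hl, inducedEven, List.filter_cons, if_neg (by simp),
      List.filter_cons, if_pos (by simp), List.filter_append, hf, List.map_cons,
      List.map_append, comp, comp, hl, List.map_map, List.map_map, inducedEven]
    congr 2
    · refine map_filter_map (fun a ha => ?_) fun a ha ha' => ?_
      · have := hb a ha
        simp only [Function.comp_apply]
        exact decide_eq_decide.2 (by omega)
      · have := hb a ha
        simp only [decide_eq_true_eq] at ha'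
        simp only [Function.comp_apply]
        omega
    · simp; omega

theorem length_lid {x : GPerm} (hx : x.OddPerm) : (lid x).length % 2 = 0 := by
  cases x with
  | anti => rfl
  | perm w =>
    have := (oddPerm_perm.1 hx).2
    rw [lid, List.length_cons]
    omega

open BinTree

theorem oddPerm_full (t : BinTree) : (full t).OddPerm := by
  rcases isDoublyAltWord_full t with h | ⟨M, f, g, h, he⟩
  · rw [h]
    exact ⟨trivial, by decide⟩
  · rw [he, oddPerm_perm, length_word]
    exact ⟨isPermWord_word h.val, by have := h.len; omega⟩

theorem evenPart_full (t : BinTree) : (full t).evenPart = snow t := by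
  induction t with
  | leaf => rfl
  | node a b iha ihb =>
    rw [full, GPerm.evenPart, inducedEven_skew _ (isPermWord_lid (oddPerm_full b).1)
      (length_lid (oddPerm_full b)), inducedEven_doubleArch (oddPerm_full a),
      inducedEven_lid (oddPerm_full b), iha, ihb, snow]

theorem oddPerm_snow (t : BinTree) : (snow t).OddPerm := by
  induction t with
  | leaf => exact ⟨trivial, by decide⟩
  | node a b iha ihb =>
    rw [snow, oddPerm_perm]
    refine ⟨(isPermWord_arch iha.1).skew (isPermWord_lid ihb.1), ?_⟩
    have h1 := length_lid ihb
    have h2 : (arch (snow a)).length % 2 = 1 := by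
      cases h : snow a with
      | anti => rfl
      | perm w =>
        rw [h] at iha
        have := (oddPerm_perm.1 iha).2
        simp [arch]
        omega
    rw [length_skew]
    omega

theorem parts_snow (t : BinTree) :
    (snow t).evenPart = evenThread t ∧ (snow t).oddPart = .perm (oddThread t) := by
  induction t with
  | leaf => simp [snow, GPerm.evenPart, GPerm.oddPart, evenThread, oddThread]
  | node a b iha ihb =>
    have hl := isPermWord_lid (oddPerm_snow b).1
    have hl' := length_lid (oddPerm_snow b)
    have ho := inducedOdd_lid (oddPerm_snow b)
    rw [ihb.2, GPerm.perm.injEq] at ho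
    rw [snow, GPerm.evenPart, GPerm.oddPart, inducedEven_skew _ hl hl', inducedOdd_skew _ hl hl',
      inducedEven_arch (oddPerm_snow a) iha.2, inducedEven_lid (oddPerm_snow b),
      inducedOdd_arch (oddPerm_snow a), ho, iha.1, ihb.1, evenThread, oddThread]
    exact ⟨rfl, rfl⟩

/-! ### Snow leopard permutations of odd length -/

theorem isSnowLeopard_odd_iff (p : GPerm) :
    IsSnowLeopard p ∧ Odd p.length ↔ ∃ t, snow t = p := by
  constructor
  · rintro ⟨h1, h2⟩
    cases p with
    | anti => exact ⟨leaf, rfl⟩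
    | perm u =>
      obtain ⟨-, s, -, hs, w, hw, rfl, rfl⟩ := h1
      obtain ⟨f, g, hfg, he⟩ := hw.exists_isCompletePair
      rw [GPerm.length, Int.odd_coe_nat, hw.isPermWord.length_inducedEven, Nat.odd_iff] at h2
      have h3 := Nat.odd_iff.1 hw.odd_length
      rw [he] at hs
      -- An even part of odd length means that the complete permutation has length 3 mod 4.
      obtain ⟨t, ht⟩ := (hfg.isDoublyAltComplete (by omega) hs).exists_full
      rw [← he] at ht
      exact ⟨t, by rw [← evenPart_full, ht, GPerm.evenPart]⟩
  · rintro ⟨t, rfl⟩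
    refine ⟨?_, (oddPerm_snow t).2⟩
    rw [← evenPart_full]
    rcases isDoublyAltWord_full t with h | ⟨M, f, g, h, he⟩
    · rw [h]; trivial
    · have hc := h.isCompletePair.isCompleteBaxter
      rw [he]
      exact ⟨⟨_, hc, rfl⟩, _, ⟨_, hc, rfl⟩, h.isDoublyAlternating, _, hc, rfl, rfl⟩

theorem isEvenThread_iff (a : GPerm) : IsEvenThread a ↔ ∃ t, evenThread t = a := by
  simp only [IsEvenThread, ← and_assoc, isSnowLeopard_odd_iff]
  constructor
  · rintro ⟨p, ⟨t, rfl⟩, rfl⟩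
    exact ⟨t, (parts_snow t).1.symm⟩
  · rintro ⟨t, rfl⟩
    exact ⟨_, ⟨t, rfl⟩, (parts_snow t).1⟩

theorem isOddThread_iff (a : GPerm) : IsOddThread a ↔ ∃ t, .perm (oddThread t) = a := by
  simp only [IsOddThread, ← and_assoc, isSnowLeopard_odd_iff]
  constructor
  · rintro ⟨p, ⟨t, rfl⟩, rfl⟩
    exact ⟨t, (parts_snow t).2.symm⟩
  · rintro ⟨t, rfl⟩
    exact ⟨_, ⟨t, rfl⟩, (parts_snow t).2⟩

theorem isJanusThread_iff (g : GPerm) : IsJanusThread g ↔ JanusBuilt g := by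
  rw [IsJanusThread, isEvenThread_iff, isOddThread_iff]
  constructor
  · rintro (rfl | ⟨h1, t, rfl⟩)
    · exact .anti
    · exact janusBuilt_of_threads h1 ⟨t, rfl⟩
  · intro h
    obtain ⟨h1, h2 | h2⟩ := h.exists_threads
    · exact .inl h2
    · exact .inr ⟨h1, h2⟩

end Janus

theorem theorem6p6 :
    (∃! K : Janus.JanusThread → List Janus.Step, Janus.IsRecursiveBijection K) ∧
    ∀ K : Janus.JanusThread → List Janus.Step, Janus.IsRecursiveBijection K →
      ∀ g : Janus.JanusThread, Janus.directPath g.1 = K g := by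
  have h := Janus.isJanusThread_iff
  exact ⟨⟨_, Janus.isRecursiveBijection_directPath h,
    fun K hK => funext fun g => (hK.eq_directPath h g).symm⟩, fun K hK => hK.eq_directPath h⟩
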